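/- Computational model: a unit-cost real RAM with index registers (natural numbers; addition, truncated subtraction, comparison), real registers (addition, subtraction, multiplication, division, square root, comparison) and an unbounded real memory addressed through index registers; every executed instruction and every test costs one step. For $n>1$, let $\Omega_i=\{v\in\mathbb{R}^d : a_i\le v\le b_i\}$, $i=1,\dots,n$, with $a_i\le b_i$ coordinatewise, be axis-aligned bounding boxes with $\bigcap_{i=1}^n\Omega_i=\varnothing$. Let $r^*$ be the infimum of the radii $r\ge 0$ of closed Euclidean balls $B(z,r)$ that meet every $\Omega_i$, let $D$ be the diameter of $\mathrm{conv}(\Omega_1\cup\dots\cup\Omega_n)$, and let $R=D/r^*$. A $(1+\varepsilon)$-approximate smallest intersecting ball (SIB) is a ball $B(z,r)$ that meets every $\Omega_i$ and has $r\le(1+\varepsilon)r^*$. (1) There are one algorithm and an absolute constant $C>0$ such that, for all such $n$, $d$, $(a_i)$, $(b_i)$ and all $\varepsilon>0$, the algorithm, given $n$, $d$, the $a_i$, the $b_i$ and $\varepsilon$, halts after at most $$C\cdot\frac{R^2\,n\,d\,\log n}{\min\{1,\varepsilon\}^2}$$ steps and outputs a $(1+\varepsilon)$-approximate SIB $B(z,r)$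 together with points $v_i\in\Omega_i$ with $\|z-v_i\|\le r$ for all $i$. In particular, for $0<\varepsilon\le 1$ the running time is $O(R^2nd\log n/\varepsilon^2)$. (2) For all $n,d\ge 1$, $a_i\le b_i$ and $h_1,\dots,h_n$ in $\mathbb{R}^d$ (here the boxes may intersect), the points $u_i$ with coordinates $u_{i,j}=a_{i,j}$ if $h_{i,j}>0$ and $u_{i,j}=b_{i,j}$ otherwise satisfy $u_i\in\operatorname{argmin}\{h_i^Tu : a_i\le u\le b_i\}$, and one algorithm computes them from $n$, $d$ and the $a_i,b_i,h_i$ in at most $C'nd$ steps, with $C'>0$ an absolute constant. -/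

import Mathlib

/-! ### The real random access machine

Unit-cost real RAM: finitely many index registers (natural numbers) and real registers are
named by a program, and an unbounded memory of real cells is addressed through index registers.
Available are `+`, truncated `-` and comparison on indices, and `+, -, *, /, √` and comparison on
reals. There is no rounding and no conversion of reals into indices. Programs are structured
(sequencing, branching, while loops) and are fixed once and for all: their size does not depend on
the input. -/

namespace RealRAM

/-- A configuration of the store. -/
structure Store where
  /-- index registers -/
  idx : ℕ → ℕ
  /-- real registers -/
  reg : ℕ → ℝ
  /-- real memory, accessible only through `load` and `store` -/
  mem : ℕ → ℝ

/-- Primitive instructions; the first argument is the destination. -/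
inductive Instr where
  | skip : Instr
  /-- `idx i := c` -/
  | iconst (i c : ℕ) : Instr
  /-- `idx i := idx j + idx k` -/
  | iadd (i j k : ℕ) : Instr
  /-- `idx i := idx j - idx k` (truncated) -/
  | isub (i j k : ℕ) : Instr
  /-- `reg r := c` -/
  | rconst (r c : ℕ) : Instr
  /-- `reg r := reg p + reg q` -/
  | radd (r p q : ℕ) : Instr
  /-- `reg r := reg p - reg q` -/
  | rsub (r p q : ℕ) : Instr
  /-- `reg r := reg p * reg q` -/
  | rmul (r p q : ℕ) : Instr
  /-- `reg r := reg p / reg q` -/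
  | rdiv (r p q : ℕ) : Instr
  /-- `reg r := √(reg p)` -/
  | rsqrt (r p : ℕ) : Instr
  /-- `reg r := mem (idx i)` -/
  | load (r i : ℕ) : Instr
  /-- `mem (idx i) := reg r` -/
  | store (i r : ℕ) : Instr

/-- The effect of a primitive instruction. The conventions `x / 0 = 0` and `√x = 0` for `x < 0`
are immaterial, since a program can test its operands first. -/
noncomputable def Instr.exec : Instr → Store → Store
  | .skip, s => s
  | .iconst i c, s => { s with idx := Function.update s.idx i c }
  | .iadd i j k, s => { s with idx := Function.update s.idx i (s.idx j + s.idx k) }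
  | .isub i j k, s => { s with idx := Function.update s.idx i (s.idx j - s.idx k) }
  | .rconst r c, s => { s with reg := Function.update s.reg r (c : ℝ) }
  | .radd r p q, s => { s with reg := Function.update s.reg r (s.reg p + s.reg q) }
  | .rsub r p q, s => { s with reg := Function.update s.reg r (s.reg p - s.reg q) }
  | .rmul r p q, s => { s with reg := Function.update s.reg r (s.reg p * s.reg q) }
  | .rdiv r p q, s => { s with reg := Function.update s.reg r (s.reg p / s.reg q) }
  | .rsqrt r p, s => { s with reg := Function.update s.reg r (Real.sqrt (s.reg p)) }
  | .load r i, s => { s with reg := Function.update s.reg r (s.mem (s.idx i)) }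
  | .store i r, s => { s with mem := Function.update s.mem (s.idx i) (s.reg r) }

/-- Tests: comparison of two index registers or of two real registers. -/
inductive Test where
  | ilt (i j : ℕ) : Test
  | ile (i j : ℕ) : Test
  | rlt (p q : ℕ) : Test
  | rle (p q : ℕ) : Test

/-- The truth value of a test. -/
def Test.Holds : Test → Store → Prop
  | .ilt i j, s => s.idx i < s.idx j
  | .ile i j, s => s.idx i ≤ s.idx j
  | .rlt p q, s => s.reg p < s.reg q
  | .rle p q, s => s.reg p ≤ s.reg q

/-- Programs. -/
inductive Prog where
  | instr (c : Instr) : Prog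
  | seq (P Q : Prog) : Prog
  | ite (b : Test) (P Q : Prog) : Prog
  | loop (b : Test) (P : Prog) : Prog

/-- `Runs P s t s'`: started in the store `s`, the program `P` halts in the store `s'` after exactly
`t` steps, where every executed instruction and every evaluated test counts one step. -/
inductive Runs : Prog → Store → ℕ → Store → Prop where
  | instr (c : Instr) (s : Store) : Runs (.instr c) s 1 (c.exec s)
  | seq {P Q : Prog} {s s' s'' : Store} {t t' : ℕ} :
      Runs P s t s' → Runs Q s' t' s'' → Runs (.seq P Q) s (t + t') s''
  | ite_true {b : Test} {P Q : Prog} {s s' : Store} {t : ℕ} :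
      b.Holds s → Runs P s t s' → Runs (.ite b P Q) s (1 + t) s'
  | ite_false {b : Test} {P Q : Prog} {s s' : Store} {t : ℕ} :
      ¬ b.Holds s → Runs Q s t s' → Runs (.ite b P Q) s (1 + t) s'
  | loop_true {b : Test} {P : Prog} {s s' s'' : Store} {t t' : ℕ} :
      b.Holds s → Runs P s t s' → Runs (.loop b P) s' t' s'' →
        Runs (.loop b P) s (1 + t + t') s''
  | loop_false {b : Test} {P : Prog} {s : Store} :
      ¬ b.Holds s → Runs (.loop b P) s 1 s

/-- The vectors `x 0, …, x (n - 1)` of `ℝ^d` are stored row by row from address `base` on. -/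
def Stored {n d : ℕ} (s : Store) (base : ℕ) (x : Fin n → EuclideanSpace ℝ (Fin d)) : Prop :=
  ∀ (i : Fin n) (j : Fin d), s.mem (base + ((i : ℕ) * d + (j : ℕ))) = x i j

end RealRAM

/-! ### Smallest intersecting balls -/

/-- The closed ball `B(z, r)` of radius `r ≥ 0` meets every `Ω i`. -/
def IsIntersectingBall {n d : ℕ} (Ω : Fin n → Set (EuclideanSpace ℝ (Fin d)))
    (z : EuclideanSpace ℝ (Fin d)) (r : ℝ) : Prop :=
  0 ≤ r ∧ ∀ i, (Metric.closedBall z r ∩ Ω i).Nonempty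

/-- The optimal radius `r*`. -/
noncomputable def sibRadius {n d : ℕ} (Ω : Fin n → Set (EuclideanSpace ℝ (Fin d))) : ℝ :=
  sInf {r : ℝ | ∃ z, IsIntersectingBall Ω z r}

/-- `B(z, r)` is a `(1 + ε)`-approximate smallest intersecting ball. -/
def IsApproxSIB {n d : ℕ} (Ω : Fin n → Set (EuclideanSpace ℝ (Fin d))) (ε : ℝ)
    (z : EuclideanSpace ℝ (Fin d)) (r : ℝ) : Prop :=
  IsIntersectingBall Ω z r ∧ r ≤ (1 + ε) * sibRadius Ω

/-- The diameter `D` of the input, that is, of the convex hull of all the objects. -/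
noncomputable def inputDiam {n d : ℕ} (Ω : Fin n → Set (EuclideanSpace ℝ (Fin d))) : ℝ :=
  Metric.diam (convexHull ℝ (⋃ i, Ω i))

/-- The ratio `R = D / r*`. -/
noncomputable def inputRatio {n d : ℕ} (Ω : Fin n → Set (EuclideanSpace ℝ (Fin d))) : ℝ :=
  inputDiam Ω / sibRadius Ω

/-- The axis-aligned bounding box `{v : a ≤ v ≤ b}`. -/
def aabb {d : ℕ} (a b : EuclideanSpace ℝ (Fin d)) : Set (EuclideanSpace ℝ (Fin d)) :=
  {v | ∀ j, a j ≤ v j ∧ v j ≤ b j}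

/-- The coordinatewise sign rule: `a j` where `h j > 0`, and `b j` elsewhere. -/
noncomputable def signPoint {d : ℕ} (a b h : EuclideanSpace ℝ (Fin d)) :
    EuclideanSpace ℝ (Fin d) :=
  WithLp.toLp 2 fun j => if 0 < h j then a j else b j

/-! The algorithm is a subgradient descent that certifies its own termination. Let g be the
displacement from the current point z to the nearest point of the farthest box, and λ = ε/(1+ε); a
round replaces z by z + λg. If B(w, r) meets every box and (1+ε)r ≤ ‖g‖, the obtuse-angle property
of nearest points (`inner_boxDiff_nonneg`) makes ‖z - w‖² drop by at least λ²‖g‖²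
(`norm_step_sq_le`).

Real register 4 adds up the drops λ²‖g‖², register 5 bounds the initial ‖z - w‖² for all relevant w,
and register 6 keeps the least ‖g‖² seen. Once the sum exceeds the bound, no intersecting ball has
(1+ε)r below the best radius, so the best point is good enough. The program knows neither r* nor D;
they only enter the count of rounds. Each round adds at least λ²r*² (`Farthest.sibRadius_sq_le`) and
the bound is at most 4D² (`setup_spec`), so there are at most 4R²((1+ε)/ε)² + 1 rounds of O(nd)
steps. The descent itself costs no log n; that factor is slack, as 2 log n ≥ 1 for n ≥ 2.

Memory holds the lower corners, the upper corners, the best point and the current point, in this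
order. All vector work of the descent is done by `row` with a factor c: c = 0 measures or copies, c
= λ moves, c = 1 projects. -/

namespace RealRAM

/-- Started in `s`, the program `P` halts within `T` steps in a store satisfying `Q`. -/
def HaltsWithin (P : Prog) (T : ℕ) (Q : Store → Prop) (s : Store) : Prop :=
  ∃ t s', Runs P s t s' ∧ t ≤ T ∧ Q s'

theorem HaltsWithin.mono {P : Prog} {T T' : ℕ} {Q Q' : Store → Prop} {s : Store}
    (h : HaltsWithin P T Q s) (hT : T ≤ T') (hQ : ∀ s', Q s' → Q' s') :
    HaltsWithin P T' Q' s := by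
  obtain ⟨t, s', hr, ht, hq⟩ := h
  exact ⟨t, s', hr, ht.trans hT, hQ s' hq⟩

theorem haltsWithin_instr {c : Instr} {Q : Store → Prop} {s : Store} (h : Q (c.exec s)) :
    HaltsWithin (.instr c) 1 Q s :=
  ⟨1, _, .instr c s, le_rfl, h⟩

theorem haltsWithin_seq {P P' : Prog} {T T' : ℕ} {Q Q' : Store → Prop} {s : Store}
    (h : HaltsWithin P T Q s) (h' : ∀ s', Q s' → HaltsWithin P' T' Q' s') :
    HaltsWithin (.seq P P') (T + T') Q' s := by
  obtain ⟨t, s', hr, ht, hq⟩ := h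
  obtain ⟨t', s'', hr', ht', hq'⟩ := h' s' hq
  exact ⟨t + t', s'', .seq hr hr', by omega, hq'⟩

theorem haltsWithin_ite {b : Test} {P P' : Prog} {T : ℕ} {Q : Store → Prop} {s : Store}
    (h : b.Holds s → HaltsWithin P T Q s) (h' : ¬ b.Holds s → HaltsWithin P' T Q s) :
    HaltsWithin (.ite b P P') (1 + T) Q s := by
  by_cases hb : b.Holds s
  · obtain ⟨t, s', hr, ht, hq⟩ := h hb
    exact ⟨1 + t, s', .ite_true hb hr, by omega, hq⟩
  · obtain ⟨t, s', hr, ht, hq⟩ := h' hb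
    exact ⟨1 + t, s', .ite_false hb hr, by omega, hq⟩

/-- A loop with invariant `I k` after `k` rounds that makes at most `N` rounds. -/
theorem haltsWithin_loop {b : Test} {P : Prog} {T N : ℕ} (I : ℕ → Store → Prop)
    (h : ∀ k s, I k s → b.Holds s → k < N ∧ HaltsWithin P T (I (k + 1)) s)
    {s : Store} (h0 : I 0 s) :
    HaltsWithin (.loop b P) (N * (T + 1) + 1) (fun s' => ∃ k, I k s' ∧ ¬ b.Holds s') s := by
  -- Induction on the number m of rounds still allowed. A round costs its test and at most T steps;
  -- the final 1 is the failing test.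
  have key : ∀ m k s, k + m = N → I k s →
      HaltsWithin (.loop b P) (m * (T + 1) + 1) (fun s' => ∃ k, I k s' ∧ ¬ b.Holds s') s := by
    intro m
    induction m with
    | zero =>
      intro k s hk hI
      have hb : ¬ b.Holds s := fun hb => by have := (h k s hI hb).1; omega
      exact ⟨1, s, .loop_false hb, by omega, k, hI, hb⟩
    | succ m ih =>
      intro k s hk hI
      by_cases hb : b.Holds s
      · obtain ⟨t, s', hr, ht, hq⟩ := (h k s hI hb).2
        obtain ⟨t', s'', hr', ht', hq'⟩ := ih (k + 1) s' (by omega) hq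
        refine ⟨1 + t + t', s'', .loop_true hb hr hr', ?_, hq'⟩
        rw [Nat.succ_mul]; omega
      · exact ⟨1, s, .loop_false hb, by omega, k, hI, hb⟩
  exact key N 0 s (by omega) h0

/-- Straight-line code. -/
def block : List Instr → Prog
  | [] => .instr .skip
  | c :: l => .seq (.instr c) (block l)

/-- The effect of straight-line code. -/
noncomputable def execBlock : List Instr → Store → Store
  | [], s => s
  | c :: l, s => execBlock l (c.exec s)

theorem haltsWithin_block {l : List Instr} {Q : Store → Prop} {s : Store}
    (h : Q (execBlock l s)) : HaltsWithin (block l) (l.length + 1) Q s := by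
  suffices H : Runs (block l) s (l.length + 1) (execBlock l s) from ⟨_, _, H, le_rfl, h⟩
  clear h
  induction l generalizing s with
  | nil => exact .instr .skip s
  | cons c l ih =>
    have := Runs.seq (.instr c s) (ih (s := c.exec s))
    rwa [Nat.add_comm 1] at this

/-- The index registers below `I` and the real registers below `R` agree. -/
def Frame (I R : ℕ) (s s' : Store) : Prop :=
  (∀ k < I, s'.idx k = s.idx k) ∧ ∀ k < R, s'.reg k = s.reg k

theorem Frame.trans {I R : ℕ} {s s' s'' : Store} (h : Frame I R s s') (h' : Frame I R s' s'') :
    Frame I R s s'' :=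
  ⟨fun k hk => (h'.1 k hk).trans (h.1 k hk), fun k hk => (h'.2 k hk).trans (h.2 k hk)⟩

theorem Frame.mono {I R I' R' : ℕ} {s s' : Store} (h : Frame I R s s') (hI : I' ≤ I)
    (hR : R' ≤ R) : Frame I' R' s s' :=
  ⟨fun k hk => h.1 k (by omega), fun k hk => h.2 k (by omega)⟩

/-! ### The vector routine shared by all phases of the descent -/

/-- The displacement of `x` to the nearest point of the interval `[l, u]`. -/
noncomputable def clampDiff (l u x : ℝ) : ℝ :=
  if x < l then l - x else if u < x then u - x else 0

/-- One round of `row`. -/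
def rowBody : Prog :=
  .seq (block [.iadd 21 10 20, .load 12 21, .iadd 21 11 20, .load 13 21, .iadd 21 12 20,
    .load 14 21])
  (.seq (.ite (.rlt 12 13) (.instr (.rsub 15 13 12))
    (.ite (.rlt 14 12) (.instr (.rsub 15 14 12)) (.instr (.rconst 15 0))))
  (block [.rmul 16 15 15, .radd 11 11 16, .rmul 16 10 15, .radd 12 12 16, .iadd 21 13 20,
    .store 21 12, .iadd 20 20 2]))

/-- With the vectors `x`, `l`, `u` stored from the addresses in the index registers 10, 11, 12,
store `x + c • (p - x)` from the address in register 13 and compute `‖p - x‖²` in the real register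
11, where `p` is the point of the box `[l, u]` nearest to `x` and `c` is in the real register 10. -/
def row : Prog :=
  .seq (block [.iconst 20 0, .rconst 11 0]) (.loop (.ilt 20 1) rowBody)

theorem rowBody_spec {s : Store} (h2 : s.idx 2 = 1) :
    HaltsWithin rowBody 18 (fun s' => Frame 20 11 s s' ∧ s'.idx 20 = s.idx 20 + 1 ∧
      s'.reg 11 = s.reg 11 + clampDiff (s.mem (s.idx 11 + s.idx 20)) (s.mem (s.idx 12 + s.idx 20))
        (s.mem (s.idx 10 + s.idx 20)) ^ 2 ∧
      s'.mem = Function.update s.mem (s.idx 13 + s.idx 20) (s.mem (s.idx 10 + s.idx 20) +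
        s.reg 10 * clampDiff (s.mem (s.idx 11 + s.idx 20)) (s.mem (s.idx 12 + s.idx 20))
        (s.mem (s.idx 10 + s.idx 20)))) s := by
  set x := s.mem (s.idx 10 + s.idx 20) with hx
  set l := s.mem (s.idx 11 + s.idx 20) with hl
  set u := s.mem (s.idx 12 + s.idx 20) with hu
  -- A block costs its length plus one, for the closing `skip`: 7 and 8 steps here, around a branch
  -- of at most two tests and one instruction.
  refine HaltsWithin.mono (haltsWithin_seq
    (Q := fun s' => Frame 21 12 s s' ∧ s'.mem = s.mem ∧ s'.reg 12 = x ∧ s'.reg 13 = l ∧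
      s'.reg 14 = u)
    (haltsWithin_block ?_) fun s1 h1 => haltsWithin_seq
    (Q := fun s' => Frame 21 12 s s' ∧ s'.mem = s.mem ∧ s'.reg 12 = x ∧
      s'.reg 15 = clampDiff l u x)
    (haltsWithin_ite (T := 2) (fun hb => ?_) (fun hb => haltsWithin_ite (T := 1) (fun hb' => ?_)
      (fun hb' => ?_))) fun s2 h2 => haltsWithin_block ?_) (T := 7 + (3 + 8)) le_rfl
      (fun _ h => h)
  · refine ⟨⟨?_, ?_⟩, ?_⟩
    · intro k hk
      have : k ≠ 21 := by omega
      simp [execBlock, Instr.exec, this]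
    · intro k hk
      have h1 : k ≠ 12 := by omega
      have h2 : k ≠ 13 := by omega
      have h3 : k ≠ 14 := by omega
      simp [execBlock, Instr.exec, h1, h2, h3]
    · simp [execBlock, Instr.exec, hx, hl, hu]
  · obtain ⟨hf, hm, e1, e2, e3⟩ := h1
    simp only [Test.Holds, e1, e2] at hb
    refine (haltsWithin_instr ?_).mono one_le_two (fun _ h => h)
    refine ⟨⟨hf.1, fun k hk => ?_⟩, hm, ?_, ?_⟩
    · have : k ≠ 15 := by omega
      simp [Instr.exec, this, hf.2 k hk]
    · simp [Instr.exec, e1]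
    · simp [Instr.exec, e1, e2, clampDiff, hb]
  · obtain ⟨hf, hm, e1, e2, e3⟩ := h1
    simp only [Test.Holds, e1, e2, e3] at hb hb'
    refine haltsWithin_instr ?_
    refine ⟨⟨hf.1, fun k hk => ?_⟩, hm, ?_, ?_⟩
    · have : k ≠ 15 := by omega
      simp [Instr.exec, this, hf.2 k hk]
    · simp [Instr.exec, e1]
    · simp [Instr.exec, e1, e3, clampDiff, hb, hb']
  · obtain ⟨hf, hm, e1, e2, e3⟩ := h1
    simp only [Test.Holds, e1, e2, e3] at hb hb'
    refine haltsWithin_instr ?_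
    refine ⟨⟨hf.1, fun k hk => ?_⟩, hm, ?_, ?_⟩
    · have : k ≠ 15 := by omega
      simp [Instr.exec, this, hf.2 k hk]
    · simp [Instr.exec, e1]
    · simp [Instr.exec, clampDiff, hb, hb']
  · obtain ⟨hf, hm, e1, e2⟩ := h2
    have f20 := hf.1 20 (by omega)
    have f13 := hf.1 13 (by omega)
    have f2 := hf.1 2 (by omega)
    have r10 := hf.2 10 (by omega)
    have r11 := hf.2 11 (by omega)
    refine ⟨⟨?_, ?_⟩, ?_, ?_, ?_⟩
    · intro k hk
      have h1 : k ≠ 21 := by omega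
      have h2 : k ≠ 20 := by omega
      simp [execBlock, Instr.exec, h1, h2, hf.1 k (by omega)]
    · intro k hk
      have h1 : k ≠ 16 := by omega
      have h2 : k ≠ 11 := by omega
      have h3 : k ≠ 12 := by omega
      simp [execBlock, Instr.exec, h1, h2, h3, hf.2 k (by omega)]
    · simp [execBlock, Instr.exec, f20, f2, ‹s.idx 2 = 1›]
    · simp [execBlock, Instr.exec, r11, e2, sq]
    · simp [execBlock, Instr.exec, r10, f20, f13, e1, e2, hm]

/-- Cells are written in increasing order, so the output may overwrite `x` in place or begin below
it: the cells of `x` still to be read are intact. The box must lie entirely below the output. -/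
theorem row_spec {s : Store} (h2 : s.idx 2 = 1)
    (hx : s.idx 10 + s.idx 1 ≤ s.idx 13 ∨ s.idx 13 ≤ s.idx 10)
    (hl : s.idx 11 + s.idx 1 ≤ s.idx 13) (hu : s.idx 12 + s.idx 1 ≤ s.idx 13) :
    HaltsWithin row (s.idx 1 * 19 + 4) (fun s' => Frame 20 11 s s' ∧
      s'.reg 11 = ∑ j ∈ Finset.range (s.idx 1), clampDiff (s.mem (s.idx 11 + j))
        (s.mem (s.idx 12 + j)) (s.mem (s.idx 10 + j)) ^ 2 ∧
      (∀ j < s.idx 1, s'.mem (s.idx 13 + j) = s.mem (s.idx 10 + j) + s.reg 10 *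
        clampDiff (s.mem (s.idx 11 + j)) (s.mem (s.idx 12 + j)) (s.mem (s.idx 10 + j))) ∧
      ∀ k, k < s.idx 13 ∨ s.idx 13 + s.idx 1 ≤ k → s'.mem k = s.mem k) s := by
  refine HaltsWithin.mono (haltsWithin_seq
    (Q := fun s' => Frame 20 11 s s' ∧ s'.mem = s.mem ∧ s'.idx 20 = 0 ∧ s'.reg 11 = 0)
    (haltsWithin_block ?_) fun s1 h1 => haltsWithin_loop (N := s.idx 1) (T := 18)
    (fun i s' => Frame 20 11 s s' ∧ s'.idx 20 = i ∧ i ≤ s.idx 1 ∧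
      s'.reg 11 = ∑ j ∈ Finset.range i, clampDiff (s.mem (s.idx 11 + j))
        (s.mem (s.idx 12 + j)) (s.mem (s.idx 10 + j)) ^ 2 ∧
      (∀ j < i, s'.mem (s.idx 13 + j) = s.mem (s.idx 10 + j) + s.reg 10 *
        clampDiff (s.mem (s.idx 11 + j)) (s.mem (s.idx 12 + j)) (s.mem (s.idx 10 + j))) ∧
      ∀ k, k < s.idx 13 ∨ s.idx 13 + i ≤ k → s'.mem k = s.mem k)
    ?_ ?_) (T := 3 + (s.idx 1 * 19 + 1)) (by omega) ?_
  · refine ⟨⟨?_, ?_⟩, ?_⟩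
    · intro k hk
      have : k ≠ 20 := by omega
      simp [execBlock, Instr.exec, this]
    · intro k hk
      have h1 : k ≠ 11 := by omega
      simp [execBlock, Instr.exec, h1]
    · simp [execBlock, Instr.exec]
  · rintro i s' ⟨hf, hi, hid, hs, hw, hk⟩ hb
    simp only [Test.Holds, hi, hf.1 1 (by omega)] at hb
    refine ⟨hb, (rowBody_spec (by rw [hf.1 2 (by omega), h2])).mono le_rfl ?_⟩
    rintro s'' ⟨hf', hi', hs', hm'⟩
    rw [hi, hf.1 10 (by omega), hf.1 11 (by omega), hf.1 12 (by omega), hk (s.idx 10 + i) (by omega),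
      hk (s.idx 11 + i) (by omega), hk (s.idx 12 + i) (by omega)] at hs' hm'
    rw [hf.1 13 (by omega), hf.2 10 (by omega)] at hm'
    refine ⟨hf.trans hf', by omega, by omega, ?_, ?_, ?_⟩
    · rw [hs', hs, Finset.sum_range_succ]
    · intro j hj
      rcases Nat.lt_succ_iff_lt_or_eq.mp hj with hj | rfl
      · rw [hm', Function.update_of_ne (by omega), hw j hj]
      · rw [hm', Function.update_self]
    · intro k hk'
      rw [hm', Function.update_of_ne (by omega), hk k (by omega)]
  · obtain ⟨hf, hm, hi, hr⟩ := h1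
    exact ⟨hf, hi, by omega, by simp [hr], by simp, fun k _ => by rw [hm]⟩
  · rintro s' ⟨i, ⟨hf, hi, hid, hs, hw, hk⟩, hb⟩
    simp only [Test.Holds, hi, hf.1 1 (by omega)] at hb
    obtain rfl : i = s.idx 1 := by omega
    exact ⟨hf, hs, hw, hk⟩

end RealRAM

/-! ### Geometry of boxes and intersecting balls -/

section Geometry

variable {n d : ℕ}

/-- The displacement of `z` to the nearest point of the box `[a, b]`. -/
noncomputable def boxDiff (a b z : EuclideanSpace ℝ (Fin d)) : EuclideanSpace ℝ (Fin d) :=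
  WithLp.toLp 2 fun j => RealRAM.clampDiff (a j) (b j) (z j)

theorem add_boxDiff_mem {a b : EuclideanSpace ℝ (Fin d)} (hab : ∀ j, a j ≤ b j)
    (z : EuclideanSpace ℝ (Fin d)) : z + boxDiff a b z ∈ aabb a b := by
  intro j
  have := hab j
  simp only [boxDiff, PiLp.add_apply, RealRAM.clampDiff]
  split_ifs <;> constructor <;> linarith

/-- With a one-point box, `row` computes distances between two vectors; the setup phase uses this.
-/
theorem boxDiff_self (a z : EuclideanSpace ℝ (Fin d)) : boxDiff a a z = a - z := by
  ext j
  simp only [boxDiff, PiLp.sub_apply, RealRAM.clampDiff]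
  split_ifs <;> linarith

/-- The variational inequality of projection onto a convex set. For a box it holds in every
coordinate: a nonzero displacement stops at the face it reaches first, and `q` lies on or beyond
that face. -/
theorem inner_boxDiff_nonneg {a b q : EuclideanSpace ℝ (Fin d)} (hq : q ∈ aabb a b)
    (z : EuclideanSpace ℝ (Fin d)) : 0 ≤ inner ℝ (boxDiff a b z) (q - (z + boxDiff a b z)) := by
  rw [PiLp.inner_apply]
  refine Finset.sum_nonneg fun j _ => ?_
  obtain ⟨h1, h2⟩ := hq j
  simp only [boxDiff, PiLp.add_apply, PiLp.sub_apply, RealRAM.clampDiff, RCLike.inner_apply,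
    conj_trivial]
  split_ifs <;> nlinarith

theorem norm_sub_le_of_mem_aabb {a b v w : EuclideanSpace ℝ (Fin d)} (hv : v ∈ aabb a b)
    (hw : w ∈ aabb a b) : ‖v - w‖ ≤ ‖b - a‖ := by
  rw [EuclideanSpace.norm_eq, EuclideanSpace.norm_eq]
  refine Real.sqrt_le_sqrt (Finset.sum_le_sum fun j _ => ?_)
  obtain ⟨h1, h2⟩ := hv j
  obtain ⟨h3, h4⟩ := hw j
  simp only [PiLp.sub_apply, Real.norm_eq_abs]
  rw [sq_le_sq, abs_abs, abs_abs, abs_le, abs_of_nonneg (by linarith)]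
  constructor <;> linarith

/-- One step of the descent towards the farthest box decreases the squared distance to the centre
`w` of every intersecting ball whose radius `r` is too small. -/
theorem norm_step_sq_le {a b z w : EuclideanSpace ℝ (Fin d)} {r ε : ℝ} (hε : 0 < ε)
    (hw : (Metric.closedBall w r ∩ aabb a b).Nonempty)
    (hr : (1 + ε) * r ≤ ‖boxDiff a b z‖) :
    ‖z + (ε / (1 + ε)) • boxDiff a b z - w‖ ^ 2 +
      (ε / (1 + ε)) * (ε / (1 + ε)) * ‖boxDiff a b z‖ ^ 2 ≤ ‖z - w‖ ^ 2 := by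
  obtain ⟨q, hqw, hq⟩ := hw
  rw [Metric.mem_closedBall, dist_eq_norm] at hqw
  have h1 := inner_boxDiff_nonneg hq z
  set g := boxDiff a b z
  have h2 : inner ℝ g (q - w) ≤ ‖g‖ * r :=
    (real_inner_le_norm g (q - w)).trans (mul_le_mul_of_nonneg_left hqw (norm_nonneg g))
  -- Split z - w through q and the nearest point z + g. The first term is at most ‖g‖r, and the
  -- second has a favourable sign.
  have h3 : inner ℝ g (z - w) = inner ℝ g (q - w) - inner ℝ g (q - (z + g)) - ‖g‖ ^ 2 := by
    rw [← real_inner_self_eq_norm_sq]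
    simp only [inner_sub_right, inner_add_right]
    ring
  have h4 : z + (ε / (1 + ε)) • g - w = (z - w) + (ε / (1 + ε)) • g := by abel
  rw [h4, norm_add_sq_real, inner_smul_right, norm_smul, mul_pow, Real.norm_eq_abs, sq_abs,
    real_inner_comm, h3]
  set l := ε / (1 + ε) with hl
  have hl0 : 0 < l := by positivity
  -- This is where the step length comes from: 1 - λ = 1/(1+ε).
  have hr' : r ≤ (1 - l) * ‖g‖ := by
    have : 1 - l = 1 / (1 + ε) := by rw [hl]; field_simp; ring
    rw [this, one_div, ← div_eq_inv_mul, le_div_iff₀ (by positivity)]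
    linarith
  have h5 : ‖g‖ * r ≤ (1 - l) * ‖g‖ ^ 2 := by nlinarith [norm_nonneg g]
  have h6 : inner ℝ g (q - w) - inner ℝ g (q - (z + g)) - ‖g‖ ^ 2 ≤ -(l * ‖g‖ ^ 2) := by
    linarith
  have h7 := mul_le_mul_of_nonneg_left h6 hl0.le
  -- The linear term gains 2λ²‖g‖² and the quadratic term loses λ²‖g‖².
  linarith

variable {a b : Fin n → EuclideanSpace ℝ (Fin d)}

theorem isIntersectingBall_of_norm_boxDiff_le (hab : ∀ i j, a i j ≤ b i j)
    {z : EuclideanSpace ℝ (Fin d)} {r : ℝ} (hr : 0 ≤ r) (h : ∀ i, ‖boxDiff (a i) (b i) z‖ ≤ r) :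
    IsIntersectingBall (fun i => aabb (a i) (b i)) z r :=
  ⟨hr, fun i => ⟨z + boxDiff (a i) (b i) z, by simpa using h i, add_boxDiff_mem (hab i) z⟩⟩

theorem sibRadius_le {Ω : Fin n → Set (EuclideanSpace ℝ (Fin d))}
    {z : EuclideanSpace ℝ (Fin d)} {r : ℝ} (h : IsIntersectingBall Ω z r) : sibRadius Ω ≤ r :=
  csInf_le ⟨0, fun _ ⟨_, h⟩ => h.1⟩ ⟨z, h⟩

theorem exists_isIntersectingBall (hab : ∀ i j, a i j ≤ b i j) :
    ∃ r z, IsIntersectingBall (fun i => aabb (a i) (b i)) z r :=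
  ⟨∑ i, ‖boxDiff (a i) (b i) 0‖, 0, isIntersectingBall_of_norm_boxDiff_le hab
    (Finset.sum_nonneg fun _ _ => norm_nonneg _) fun i =>
    Finset.single_le_sum (f := fun i => ‖boxDiff (a i) (b i) 0‖) (fun _ _ => norm_nonneg _)
      (Finset.mem_univ i)⟩

/-- Boxes without a common point are separated in some coordinate. -/
theorem exists_lt_of_iInter_aabb_eq_empty (hn : 0 < n)
    (h : (⋂ i, aabb (a i) (b i)) = ∅) : ∃ i i' j, b i' j < a i j := by
  by_contra! hc
  have : Nonempty (Fin n) := ⟨⟨0, hn⟩⟩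
  -- Helly in dimension one, coordinate by coordinate: the largest lower end lies below every upper
  -- end.
  have hmem : (WithLp.toLp 2 fun j => Finset.univ.sup' Finset.univ_nonempty fun i => a i j) ∈
      ⋂ i, aabb (a i) (b i) := by
    refine Set.mem_iInter.2 fun i j => ⟨?_, ?_⟩
    · exact Finset.le_sup' (fun i => a i j) (Finset.mem_univ i)
    · exact Finset.sup'_le Finset.univ_nonempty _ fun i' _ => hc i' i j
  rw [h] at hmem
  exact hmem

/-- A ball meeting two boxes separated by a gap in one coordinate has diameter at least that gap. -/
theorem sibRadius_pos (hn : 0 < n) (hab : ∀ i j, a i j ≤ b i j)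
    (h : (⋂ i, aabb (a i) (b i)) = ∅) : 0 < sibRadius (fun i => aabb (a i) (b i)) := by
  obtain ⟨i, i', j, hlt⟩ := exists_lt_of_iInter_aabb_eq_empty hn h
  refine lt_of_lt_of_le (b := (a i j - b i' j) / 2) (by linarith) (le_csInf ?_ ?_)
  · exact exists_isIntersectingBall hab
  · rintro r ⟨z, -, hz⟩
    obtain ⟨p, hp, hpi⟩ := hz i
    obtain ⟨q, hq, hqi⟩ := hz i'
    rw [Metric.mem_closedBall, dist_eq_norm] at hp hq
    have h1 := (abs_le.1 ((PiLp.norm_apply_le (p - z) j).trans hp)).2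
    have h2 := (abs_le.1 ((PiLp.norm_apply_le (q - z) j).trans hq)).1
    have h3 := (hpi j).1
    have h4 := (hqi j).2
    simp only [PiLp.sub_apply] at h1 h2
    linarith

theorem norm_sub_le_inputDiam {v w : EuclideanSpace ℝ (Fin d)} {i i' : Fin n}
    (hv : v ∈ aabb (a i) (b i)) (hw : w ∈ aabb (a i') (b i')) :
    ‖v - w‖ ≤ inputDiam (fun i => aabb (a i) (b i)) := by
  rw [← dist_eq_norm]
  refine Metric.dist_le_diam_of_mem ?_
    (subset_convexHull ℝ _ (Set.mem_iUnion.2 ⟨i, hv⟩))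
    (subset_convexHull ℝ _ (Set.mem_iUnion.2 ⟨i', hw⟩))
  -- Boundedness is essential: `Metric.diam` is 0 on unbounded sets.
  rw [isBounded_convexHull, Bornology.isBounded_iUnion]
  intro i
  refine Metric.isBounded_iff.2 ⟨‖b i - a i‖, fun x hx y hy => ?_⟩
  rw [dist_eq_norm]
  exact norm_sub_le_of_mem_aabb hx hy

/-- The distance from a point of a box to the centre of an intersecting ball. -/
theorem norm_sub_sq_le_of_mem_aabb {a b z w : EuclideanSpace ℝ (Fin d)} {r : ℝ}
    (hz : z ∈ aabb a b) (hw : (Metric.closedBall w r ∩ aabb a b).Nonempty) :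
    ‖z - w‖ ^ 2 ≤ 2 * (‖b - a‖ ^ 2 + r ^ 2) := by
  obtain ⟨q, hqw, hq⟩ := hw
  rw [Metric.mem_closedBall, dist_eq_norm] at hqw
  have h1 := norm_sub_le_of_mem_aabb hz hq
  have h2 : ‖z - w‖ ≤ ‖b - a‖ + r := by
    calc ‖z - w‖ = ‖(z - q) + (q - w)‖ := by congr 1; abel
      _ ≤ _ := (norm_add_le _ _).trans (add_le_add h1 hqw)
  nlinarith [sq_nonneg (‖b - a‖ - r), norm_nonneg (z - w), norm_nonneg (b - a)]

theorem signPoint_mem_aabb {a b : EuclideanSpace ℝ (Fin d)} (hab : ∀ j, a j ≤ b j)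
    (h : EuclideanSpace ℝ (Fin d)) : signPoint a b h ∈ aabb a b := by
  intro j
  have := hab j
  simp only [signPoint]
  split_ifs <;> constructor <;> linarith

/-- A linear form on a box is minimised in each coordinate separately; where the coefficient
vanishes, either end serves. -/
theorem isMinOn_signPoint (a b h : EuclideanSpace ℝ (Fin d)) :
    IsMinOn (fun u => inner ℝ h u) (aabb a b) (signPoint a b h) := by
  intro u hu
  simp only [Set.mem_ofPred_eq, PiLp.inner_apply, RCLike.inner_apply, conj_trivial]
  refine Finset.sum_le_sum fun j _ => ?_
  obtain ⟨h1, h2⟩ := hu j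
  simp only [signPoint]
  split_ifs with hj <;> nlinarith

end Geometry

/-! ### Memory layout and the search for the farthest box -/

namespace RealRAM

variable {n d : ℕ}

/-- The vector `x` is stored from address `p` on. -/
def VecAt (s : Store) (p : ℕ) (x : EuclideanSpace ℝ (Fin d)) : Prop :=
  ∀ j : Fin d, s.mem (p + j) = x j

theorem VecAt.congr {s s' : Store} {p : ℕ} {x : EuclideanSpace ℝ (Fin d)} (h : VecAt s p x)
    (hm : ∀ k, p ≤ k → k < p + d → s'.mem k = s.mem k) : VecAt s' p x :=
  fun j => (hm _ (by omega) (by omega)).trans (h j)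

theorem row_spec_vec {s : Store} {x l u : EuclideanSpace ℝ (Fin d)} (h1 : s.idx 1 = d)
    (h2 : s.idx 2 = 1) (hx : s.idx 10 + d ≤ s.idx 13 ∨ s.idx 13 ≤ s.idx 10)
    (hl : s.idx 11 + d ≤ s.idx 13) (hu : s.idx 12 + d ≤ s.idx 13)
    (vx : VecAt s (s.idx 10) x) (vl : VecAt s (s.idx 11) l) (vu : VecAt s (s.idx 12) u) :
    HaltsWithin row (d * 19 + 4) (fun s' => Frame 20 11 s s' ∧
      s'.reg 11 = ‖boxDiff l u x‖ ^ 2 ∧ VecAt s' (s.idx 13) (x + s.reg 10 • boxDiff l u x) ∧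
      ∀ k, k < s.idx 13 ∨ s.idx 13 + d ≤ k → s'.mem k = s.mem k) s := by
  have := row_spec h2 (by rwa [h1]) (by rwa [h1]) (by rwa [h1])
  rw [h1] at this
  refine this.mono le_rfl ?_
  rintro s' ⟨hf, hs, hw, hk⟩
  refine ⟨hf, ?_, fun j => ?_, hk⟩
  · rw [hs, Finset.sum_range, EuclideanSpace.real_norm_sq_eq]
    exact Finset.sum_congr rfl fun j _ => by rw [vx j, vl j, vu j]; rfl
  · rw [hw j j.2, vx j, vl j, vu j]
    rfl

/-- For `omega` the products are atoms; this supplies a relation between them that the address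
arithmetic needs. -/
theorem fin_mul_add_le (i : Fin n) : i * d + d ≤ n * d := by
  rw [← Nat.succ_mul]
  exact Nat.mul_le_mul_right d i.2

/-- The registers and memory cells that stay fixed during the computation. -/
structure Ctx (a b : Fin n → EuclideanSpace ℝ (Fin d)) (ε : ℝ) (s : Store) : Prop where
  idx0 : s.idx 0 = n
  idx1 : s.idx 1 = d
  idx2 : s.idx 2 = 1
  idx3 : s.idx 3 = n * d
  idx4 : s.idx 4 = 2 * (n * d)
  idx5 : s.idx 5 = 2 * (n * d) + d
  idx6 : s.idx 6 = 0
  reg1 : s.reg 1 = ε / (1 + ε)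
  reg2 : s.reg 2 = 0
  reg3 : s.reg 3 = ε / (1 + ε) * (ε / (1 + ε))
  lower : ∀ i : Fin n, VecAt s (i * d) (a i)
  upper : ∀ i : Fin n, VecAt s (n * d + i * d) (b i)

variable {a b : Fin n → EuclideanSpace ℝ (Fin d)} {ε : ℝ}

theorem Ctx.congr {s s' : Store} (h : Ctx a b ε s) (hf : Frame 7 4 s s')
    (hm : ∀ k < 2 * (n * d), s'.mem k = s.mem k) : Ctx a b ε s' where
  idx0 := (hf.1 0 (by omega)).trans h.idx0
  idx1 := (hf.1 1 (by omega)).trans h.idx1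
  idx2 := (hf.1 2 (by omega)).trans h.idx2
  idx3 := (hf.1 3 (by omega)).trans h.idx3
  idx4 := (hf.1 4 (by omega)).trans h.idx4
  idx5 := (hf.1 5 (by omega)).trans h.idx5
  idx6 := (hf.1 6 (by omega)).trans h.idx6
  reg1 := (hf.2 1 (by omega)).trans h.reg1
  reg2 := (hf.2 2 (by omega)).trans h.reg2
  reg3 := (hf.2 3 (by omega)).trans h.reg3
  lower i := (h.lower i).congr fun k _ hk => hm k (by have := fin_mul_add_le (d := d) i; omega)
  upper i := (h.upper i).congr fun k _ hk => hm k (by have := fin_mul_add_le (d := d) i; omega)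

/-- Real register 7 holds the squared distance from `z` to the farthest box, and index register 7
the address of a farthest box. -/
def Farthest (a b : Fin n → EuclideanSpace ℝ (Fin d)) (z : EuclideanSpace ℝ (Fin d))
    (s : Store) : Prop :=
  (∀ i, ‖boxDiff (a i) (b i) z‖ ^ 2 ≤ s.reg 7) ∧
    ∃ i : Fin n, s.idx 7 = i * d ∧ s.reg 7 = ‖boxDiff (a i) (b i) z‖ ^ 2

/-- Find the box farthest from the current point. -/
def scan : Prog :=
  .seq (block [.iadd 10 5 6, .iadd 13 5 6, .iconst 11 0, .iadd 12 3 6, .iconst 7 0, .rconst 7 0,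
    .rconst 10 0])
  (.loop (.ilt 11 3) (.seq row
    (.seq (.ite (.rle 7 11) (block [.radd 7 11 2, .iadd 7 11 6]) (.instr .skip))
      (block [.iadd 11 11 1, .iadd 12 12 1]))))

theorem scan_spec (hn : 0 < n) (hd : 0 < d) {s : Store} (h : Ctx a b ε s) {z : EuclideanSpace ℝ (Fin d)}
    (hz : VecAt s (2 * (n * d) + d) z) :
    HaltsWithin scan (n * (d * 19 + 12) + 9) (fun s' => Frame 7 7 s s' ∧ s'.mem = s.mem ∧
      Farthest a b z s') s := by
  refine HaltsWithin.mono (haltsWithin_seq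
    (Q := fun s' => Frame 7 7 s s' ∧ s'.mem = s.mem ∧ s'.idx 10 = 2 * (n * d) + d ∧
      s'.idx 13 = 2 * (n * d) + d ∧ s'.idx 11 = 0 ∧ s'.idx 12 = n * d ∧ s'.reg 10 = 0 ∧
      s'.reg 7 = 0)
    (haltsWithin_block ?_) fun s1 h1 => haltsWithin_loop (N := n)
    (T := (d * 19 + 4) + ((1 + 3) + 3))
    (fun k s' => Frame 7 7 s s' ∧ s'.mem = s.mem ∧ s'.idx 10 = 2 * (n * d) + d ∧
      s'.idx 13 = 2 * (n * d) + d ∧ s'.idx 11 = k * d ∧ s'.idx 12 = n * d + k * d ∧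
      s'.reg 10 = 0 ∧ k ≤ n ∧ (∀ i : Fin n, i < k → ‖boxDiff (a i) (b i) z‖ ^ 2 ≤ s'.reg 7) ∧
      ((k = 0 ∧ s'.reg 7 = 0) ∨
        ∃ i : Fin n, s'.idx 7 = i * d ∧ s'.reg 7 = ‖boxDiff (a i) (b i) z‖ ^ 2))
    ?_ ?_) (T := 8 + (n * (d * 19 + 4 + (1 + 3 + 3) + 1) + 1)) (by ring_nf; omega) ?_
  · refine ⟨⟨?_, ?_⟩, ?_⟩
    · intro k hk
      have h1 : k ≠ 10 := by omega
      have h2 : k ≠ 11 := by omega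
      have h3 : k ≠ 12 := by omega
      have h4 : k ≠ 13 := by omega
      have h5 : k ≠ 7 := by omega
      simp [execBlock, Instr.exec, h1, h2, h3, h4, h5]
    · intro k hk
      have h1 : k ≠ 7 := by omega
      have h2 : k ≠ 10 := by omega
      simp [execBlock, Instr.exec, h1, h2]
    · simp [execBlock, Instr.exec, h.idx5, h.idx6, h.idx3]
  · rintro k s' ⟨hf, hm, i10, i13, i11, i12, r10, hk, hle, hex⟩ hb
    have hc : Ctx a b ε s' := h.congr (hf.mono le_rfl (by omega)) (fun k _ => by rw [hm])
    simp only [Test.Holds, i11, hc.idx3] at hb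
    have hkn : k < n := lt_of_mul_lt_mul_right hb (Nat.zero_le d)
    refine ⟨hkn, ?_⟩
    have hkd := fin_mul_add_le (d := d) (⟨k, hkn⟩ : Fin n)
    simp only at hkd
    refine haltsWithin_seq (row_spec_vec (x := z) (l := a ⟨k, hkn⟩) (u := b ⟨k, hkn⟩) hc.idx1
      hc.idx2 (by omega) (by omega) (by omega) (by rw [i10]; exact hz.congr fun _ _ _ => by rw [hm])
      (by rw [i11]; exact hc.lower ⟨k, hkn⟩) (by rw [i12]; exact hc.upper ⟨k, hkn⟩)) ?_
    rintro s1 ⟨hf1, hr1, hv1, hm1⟩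
    rw [i13, r10, zero_smul, add_zero] at hv1
    -- With c = 0 the current point is written over itself, so measuring leaves the memory
    -- unchanged.
    have hm1 : s1.mem = s.mem := by
      funext k
      by_cases hk : k < 2 * (n * d) + d ∨ 2 * (n * d) + d + d ≤ k
      · rw [hm1 k (by rwa [i13]), hm]
      · obtain ⟨j, rfl⟩ := Nat.exists_eq_add_of_le (show 2 * (n * d) + d ≤ k by omega)
        rw [hv1 ⟨j, by omega⟩, hz ⟨j, by omega⟩]
    have hc1 : Ctx a b ε s1 := hc.congr (hf1.mono (by omega) (by omega))
      (fun k _ => by rw [hm1, hm])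
    refine haltsWithin_seq (Q := fun s2 => Frame 7 7 s s2 ∧ s2.mem = s.mem ∧
      s2.idx 10 = 2 * (n * d) + d ∧ s2.idx 13 = 2 * (n * d) + d ∧ s2.idx 11 = k * d ∧
      s2.idx 12 = n * d + k * d ∧ s2.reg 10 = 0 ∧
      (∀ i : Fin n, i < k + 1 → ‖boxDiff (a i) (b i) z‖ ^ 2 ≤ s2.reg 7) ∧
      ∃ i : Fin n, s2.idx 7 = i * d ∧ s2.reg 7 = ‖boxDiff (a i) (b i) z‖ ^ 2)
      (haltsWithin_ite (fun hle' => haltsWithin_block ?_) (fun hlt =>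
        (haltsWithin_instr ?_).mono (by simp) fun _ h => h))
      fun s2 h2 => haltsWithin_block ?_
    · simp only [Test.Holds, hf1.2 7 (by omega)] at hle'
      refine ⟨⟨fun j hj => ?_, fun j hj => ?_⟩, hm1, ?_⟩
      · have h1 : j ≠ 7 := by omega
        simp [execBlock, Instr.exec, h1, hf1.1 j (by omega), hf.1 j hj]
      · have h1 : j ≠ 7 := by omega
        simp [execBlock, Instr.exec, h1, hf1.2 j (by omega), hf.2 j hj]
      · simp only [execBlock, Instr.exec, Function.update_self, ne_eq,
          Nat.reduceEqDiff, not_false_eq_true, Function.update_of_ne, hc1.reg2, hc1.idx6, add_zero,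
          hf1.1 10 (by omega), hf1.1 11 (by omega), hf1.1 12 (by omega), hf1.1 13 (by omega),
          hf1.2 10 (by omega), i10, i11, i12, i13, r10, true_and]
        refine ⟨fun i hi => ?_, ⟨k, hkn⟩, rfl, hr1⟩
        rcases Nat.lt_succ_iff_lt_or_eq.mp hi with hi | rfl
        · exact (hle i hi).trans hle'
        · exact hr1.ge
    · simp only [Test.Holds, hf1.2 7 (by omega), not_le] at hlt
      simp only [Instr.exec, hf1.1 10 (by omega), hf1.1 11 (by omega), hf1.1 12 (by omega),
        hf1.1 13 (by omega), hf1.2 10 (by omega), i10, i11, i12, i13, r10, true_and, hm1,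
        hf1.1 7 (by omega), hf1.2 7 (by omega)]
      refine ⟨hf.trans (hf1.mono (by omega) (by omega)), fun i hi => ?_, ?_⟩
      · rcases Nat.lt_succ_iff_lt_or_eq.mp hi with hi | rfl
        · exact hle i hi
        · exact hr1.ge.trans hlt.le
      -- The maximum starts at 0 and ties are accepted, so the first box is always recorded, even at
      -- distance 0.
      · refine hex.resolve_left fun ⟨_, h0⟩ => ?_
        rw [h0, hr1] at hlt
        exact absurd hlt (not_lt.2 (sq_nonneg _))
    · obtain ⟨g1, g2, g3, g4, g5, g6, g7, g8, g9⟩ := h2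
      refine ⟨⟨fun j hj => ?_, g1.2⟩, g2, ?_⟩
      · have h1 : j ≠ 11 := by omega
        have h2 : j ≠ 12 := by omega
        simp [execBlock, Instr.exec, h1, h2, g1.1 j hj]
      · have g10 : s2.idx 1 = d := (g1.1 1 (by omega)).trans h.idx1
        simp only [execBlock, Instr.exec, Function.update_self, ne_eq,
          Nat.reduceEqDiff, not_false_eq_true, Function.update_of_ne, g3, g4, g5, g6, g7, g10,
          OfNat.one_ne_ofNat, Nat.succ_mul, true_and, Nat.add_assoc]
        exact ⟨hkn, g8, Or.inr g9⟩
  · obtain ⟨hf, hm, i10, i13, i11, i12, r10, r7⟩ := h1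
    exact ⟨hf, hm, i10, i13, by simpa using i11, by simpa using i12, r10, Nat.zero_le n,
      by simp, Or.inl ⟨rfl, r7⟩⟩
  · rintro s' ⟨k, ⟨hf, hm, i10, i13, i11, i12, r10, hk, hle, hex⟩, hb⟩
    simp only [Test.Holds, i11, (hf.1 3 (by omega)).trans h.idx3, not_lt] at hb
    -- The loop compares k * d with n * d, so leaving it identifies k only because d > 0.
    obtain rfl : k = n := hk.antisymm (Nat.le_of_mul_le_mul_right hb hd)
    exact ⟨hf, hm, fun i => hle i i.2, hex.resolve_left fun h => hn.ne' h.1⟩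

end RealRAM

/-! ### The descent loop and the output phase -/

namespace RealRAM

variable {n d : ℕ} {a b : Fin n → EuclideanSpace ℝ (Fin d)} {ε : ℝ}

/-- Record the current point as the best one. -/
def copyBest : Prog :=
  .seq (block [.iadd 10 5 6, .iadd 13 4 6, .iconst 11 0, .iconst 12 0, .rconst 10 0]) row

/-- With c = 0 the box is irrelevant; the first lower corner stands in for it, lying below the
target since n > 0. -/
theorem copyBest_spec (hn : 0 < n) {s : Store} (h : Ctx a b ε s) {z : EuclideanSpace ℝ (Fin d)}
    (hz : VecAt s (2 * (n * d) + d) z) :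
    HaltsWithin copyBest (d * 19 + 10) (fun s' => Frame 10 10 s s' ∧ VecAt s' (2 * (n * d)) z ∧
      ∀ k, k < 2 * (n * d) ∨ 2 * (n * d) + d ≤ k → s'.mem k = s.mem k) s := by
  have hnd := fin_mul_add_le (d := d) (⟨0, hn⟩ : Fin n)
  simp only at hnd
  refine (haltsWithin_seq
    (Q := fun s' => Frame 10 10 s s' ∧ s'.mem = s.mem ∧ s'.idx 10 = 2 * (n * d) + d ∧
      s'.idx 13 = 2 * (n * d) ∧ s'.idx 11 = 0 ∧ s'.idx 12 = 0 ∧ s'.reg 10 = 0)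
    (haltsWithin_block ?_) fun s1 h1 => ?_).mono
      (T := 6 + (d * 19 + 4)) (by omega) fun _ h => h
  · refine ⟨⟨?_, ?_⟩, ?_⟩
    · intro k hk
      have h1 : k ≠ 10 := by omega
      have h2 : k ≠ 11 := by omega
      have h3 : k ≠ 12 := by omega
      have h4 : k ≠ 13 := by omega
      simp [execBlock, Instr.exec, h1, h2, h3, h4]
    · intro k hk
      have h1 : k ≠ 10 := by omega
      simp [execBlock, Instr.exec, h1]
    · simp [execBlock, Instr.exec, h.idx5, h.idx6, h.idx4]
  · obtain ⟨hf, hm, i10, i13, i11, i12, r10⟩ := h1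
    have hc : Ctx a b ε s1 := h.congr (hf.mono (by omega) (by omega)) fun k _ => by rw [hm]
    have ha : VecAt s1 0 (a ⟨0, hn⟩) := by simpa using hc.lower ⟨0, hn⟩
    refine (row_spec_vec (x := z) (l := a ⟨0, hn⟩) (u := a ⟨0, hn⟩) hc.idx1
      hc.idx2 (by omega) (by omega) (by omega)
      (by rw [i10]; exact hz.congr fun _ _ _ => by rw [hm]) (by rwa [i11]) (by rwa [i12])).mono
      le_rfl ?_
    rintro s' ⟨hf', -, hv, hk⟩
    rw [r10, zero_smul, add_zero, i13] at hv
    exact ⟨hf.trans (hf'.mono (by omega) (by omega)), hv, fun k hk' => by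
      rw [hk k (by rwa [i13]), hm]⟩

/-- Move the current point towards the farthest box. -/
def moveCurrent : Prog :=
  .seq (block [.rmul 11 3 7, .radd 4 4 11, .iadd 10 5 6, .iadd 13 5 6, .iadd 11 7 6, .iadd 12 7 3,
    .radd 10 1 2]) row

/-- Under `Farthest`, the amount added to real register 4 is exactly the drop guaranteed by
`norm_step_sq_le`. -/
theorem moveCurrent_spec {s : Store} (h : Ctx a b ε s) {z : EuclideanSpace ℝ (Fin d)}
    (hz : VecAt s (2 * (n * d) + d) z) {i : Fin n} (hi : s.idx 7 = i * d) :
    HaltsWithin moveCurrent (d * 19 + 12) (fun s' => Frame 7 4 s s' ∧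
      s'.reg 4 = s.reg 4 + ε / (1 + ε) * (ε / (1 + ε)) * s.reg 7 ∧ s'.reg 5 = s.reg 5 ∧
      s'.reg 6 = s.reg 6 ∧
      VecAt s' (2 * (n * d) + d) (z + (ε / (1 + ε)) • boxDiff (a i) (b i) z) ∧
      ∀ k < 2 * (n * d) + d, s'.mem k = s.mem k) s := by
  have hnd := fin_mul_add_le (d := d) i
  refine (haltsWithin_seq
    (Q := fun s' => Frame 7 4 s s' ∧ s'.mem = s.mem ∧ s'.idx 10 = 2 * (n * d) + d ∧
      s'.idx 13 = 2 * (n * d) + d ∧ s'.idx 11 = i * d ∧ s'.idx 12 = n * d + i * d ∧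
      s'.reg 10 = ε / (1 + ε) ∧ s'.reg 4 = s.reg 4 + ε / (1 + ε) * (ε / (1 + ε)) * s.reg 7 ∧
      s'.reg 5 = s.reg 5 ∧ s'.reg 6 = s.reg 6)
    (haltsWithin_block ?_) fun s1 h1 => ?_).mono
      (T := 8 + (d * 19 + 4)) (by omega) fun _ h => h
  · refine ⟨⟨?_, ?_⟩, ?_⟩
    · intro k hk
      have h1 : k ≠ 10 := by omega
      have h2 : k ≠ 11 := by omega
      have h3 : k ≠ 12 := by omega
      have h4 : k ≠ 13 := by omega
      simp [execBlock, Instr.exec, h1, h2, h3, h4]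
    · intro k hk
      have h1 : k ≠ 10 := by omega
      have h2 : k ≠ 11 := by omega
      have h3 : k ≠ 4 := by omega
      simp [execBlock, Instr.exec, h1, h2, h3]
    · simp [execBlock, Instr.exec, h.idx5, h.idx6, h.idx3, hi, h.reg1, h.reg2, h.reg3,
        Nat.add_comm]
  · obtain ⟨hf, hm, i10, i13, i11, i12, r10, r4, r5, r6⟩ := h1
    have hc : Ctx a b ε s1 := h.congr hf fun k _ => by rw [hm]
    refine (row_spec_vec (x := z) (l := a i) (u := b i) hc.idx1
      hc.idx2 (by omega) (by omega) (by omega)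
      (by rw [i10]; exact hz.congr fun _ _ _ => by rw [hm]) (by rw [i11]; exact hc.lower i)
      (by rw [i12]; exact hc.upper i)).mono le_rfl ?_
    rintro s' ⟨hf', -, hv, hk⟩
    rw [r10, i13] at hv
    exact ⟨hf.trans (hf'.mono (by omega) (by omega)), (hf'.2 4 (by omega)).trans r4,
      (hf'.2 5 (by omega)).trans r5, (hf'.2 6 (by omega)).trans r6, hv, fun k hk' => by
      rw [hk k (Or.inl (by rwa [i13])), hm]⟩

/-- The invariant of the main loop after `k` rounds: every intersecting ball `B(w, r)` that shows
the best radius to be too large has its centre `w` close to the current point `z`. -/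
def Descent (a b : Fin n → EuclideanSpace ℝ (Fin d)) (ε : ℝ) (k : ℕ) (s : Store) : Prop :=
  Ctx a b ε s ∧ ∃ z y, VecAt s (2 * (n * d) + d) z ∧ VecAt s (2 * (n * d)) y ∧
    Farthest a b z s ∧ (∀ i, ‖boxDiff (a i) (b i) y‖ ^ 2 ≤ s.reg 6) ∧ s.reg 6 ≤ s.reg 7 ∧
    (∀ w r, IsIntersectingBall (fun i => aabb (a i) (b i)) w r →
      (1 + ε) * r < √(s.reg 6) → ‖z - w‖ ^ 2 + s.reg 4 ≤ s.reg 5) ∧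
    k * (ε / (1 + ε) * (ε / (1 + ε)) * sibRadius (fun i => aabb (a i) (b i)) ^ 2) ≤ s.reg 4 ∧
    s.reg 5 ≤ 4 * inputDiam (fun i => aabb (a i) (b i)) ^ 2

/-- One round of the main loop. -/
def descentBody : Prog :=
  .seq moveCurrent (.seq scan
    (.ite (.rlt 7 6) (.seq (block [.radd 6 7 2]) copyBest) (.instr .skip)))

theorem sibRadius_nonneg (Ω : Fin n → Set (EuclideanSpace ℝ (Fin d))) : 0 ≤ sibRadius Ω :=
  Real.sInf_nonneg fun _ ⟨_, h⟩ => h.1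

/-- The distance to the farthest box is an admissible radius around `z`. Hence every round adds at
least λ²r*² to register 4, which forces termination. -/
theorem Farthest.sibRadius_sq_le (hab : ∀ i j, a i j ≤ b i j) {s : Store}
    {z : EuclideanSpace ℝ (Fin d)} (h : Farthest a b z s) :
    sibRadius (fun i => aabb (a i) (b i)) ^ 2 ≤ s.reg 7 := by
  obtain ⟨h1, i, -, h2⟩ := h
  have := sibRadius_le (isIntersectingBall_of_norm_boxDiff_le hab (z := z)
    (norm_nonneg (boxDiff (a i) (b i) z)) fun k =>
    (sq_le_sq₀ (norm_nonneg _) (norm_nonneg _)).1 ((h1 k).trans_eq h2))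
  rw [h2]
  exact pow_le_pow_left₀ (sibRadius_nonneg _) this 2

theorem descentBody_spec (hn : 0 < n) (hd : 0 < d) (hab : ∀ i j, a i j ≤ b i j) (hε : 0 < ε)
    {k : ℕ} {s : Store} (h : Descent a b ε k s) :
    HaltsWithin descentBody (n * (d * 19 + 12) + d * 38 + 34) (Descent a b ε (k + 1)) s := by
  obtain ⟨hc, z, y, hz, hy, hfar, hbest, hle, hinv, hk, hD⟩ := h
  obtain ⟨hmax, i, hi, hM⟩ := id hfar
  set z' := z + (ε / (1 + ε)) • boxDiff (a i) (b i) z with hz'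
  refine (haltsWithin_seq (moveCurrent_spec hc hz hi) fun s1 h1 => haltsWithin_seq
    (Q := fun s2 => Ctx a b ε s2 ∧ VecAt s2 (2 * (n * d) + d) z' ∧ VecAt s2 (2 * (n * d)) y ∧
      Farthest a b z' s2 ∧ s2.reg 4 = s.reg 4 + ε / (1 + ε) * (ε / (1 + ε)) * s.reg 7 ∧
      s2.reg 5 = s.reg 5 ∧ s2.reg 6 = s.reg 6) (T := n * (d * 19 + 12) + 9)
    ?_ fun s2 h2 => ?_).mono
    (T := (d * 19 + 12) + ((n * (d * 19 + 12) + 9) + (1 + (2 + (d * 19 + 10)))))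
    (by omega) fun _ h => h
  · obtain ⟨hf, r4, r5, r6, hv, hm⟩ := h1
    have hc1 : Ctx a b ε s1 := hc.congr hf fun k hk => hm k (by omega)
    refine (scan_spec hn hd hc1 hv).mono le_rfl ?_
    rintro s2 ⟨hf2, hm2, hfar2⟩
    refine ⟨hc1.congr (hf2.mono le_rfl (by omega)) fun k _ => by rw [hm2],
      hv.congr fun k _ _ => by rw [hm2], hy.congr fun k _ hk => by rw [hm2, hm k hk], hfar2,
      (hf2.2 4 (by omega)).trans r4, (hf2.2 5 (by omega)).trans r5,
      (hf2.2 6 (by omega)).trans r6⟩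
  · obtain ⟨hc2, hv, hy2, hfar2, r4, r5, r6⟩ := h2
    have hstep : ∀ w r, IsIntersectingBall (fun i => aabb (a i) (b i)) w r →
        (1 + ε) * r < √(s.reg 6) → ‖z' - w‖ ^ 2 + s2.reg 4 ≤ s2.reg 5 := by
      intro w r hw hr
      have h1 := hinv w r hw hr
      -- The best radius never exceeds the current one, so a ball that refutes the best radius also
      -- satisfies the hypothesis of the step lemma.
      have h2 : √(s.reg 6) ≤ ‖boxDiff (a i) (b i) z‖ := by
        rw [Real.sqrt_le_left (norm_nonneg _), ← hM]
        exact hle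
      have h3 := norm_step_sq_le hε (hw.2 i) (hr.le.trans h2)
      rw [← hz'] at h3
      rw [r4, r5, hM]
      linarith
    have hk' : ((k + 1 : ℕ) : ℝ) * (ε / (1 + ε) * (ε / (1 + ε)) *
        sibRadius (fun i => aabb (a i) (b i)) ^ 2) ≤ s2.reg 4 := by
      have := mul_le_mul_of_nonneg_left (hfar.sibRadius_sq_le hab)
        (mul_self_nonneg (ε / (1 + ε)))
      rw [r4]
      push_cast
      linarith
    refine haltsWithin_ite (fun hlt => haltsWithin_seq
      (Q := fun s3 => Frame 10 6 s2 s3 ∧ s3.mem = s2.mem ∧ s3.reg 6 = s2.reg 7 ∧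
        s3.reg 7 = s2.reg 7) (haltsWithin_block ?_)
      fun s3 h3 => ?_) (fun hle' => (haltsWithin_instr ?_).mono (by omega) fun _ h => h)
    · refine ⟨⟨fun _ _ => rfl, fun j hj => ?_⟩, ?_⟩
      · have h1 : j ≠ 6 := by omega
        simp [execBlock, Instr.exec, h1]
      · simp [execBlock, Instr.exec, hc2.reg2]
    · obtain ⟨hf3, hm3, r63, r73⟩ := h3
      simp only [Test.Holds] at hlt
      have hc3 : Ctx a b ε s3 := hc2.congr (hf3.mono (by omega) (by omega))
        fun k _ => by rw [hm3]
      refine (copyBest_spec hn hc3 (hv.congr fun k _ _ => by rw [hm3])).mono le_rfl ?_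
      rintro s4 ⟨hf4, hy4, hm4⟩
      have e6 : s4.reg 6 = s2.reg 7 := (hf4.2 6 (by omega)).trans r63
      have e7 : s4.reg 7 = s2.reg 7 := (hf4.2 7 (by omega)).trans r73
      have e4 : s4.reg 4 = s2.reg 4 := (hf4.2 4 (by omega)).trans (hf3.2 4 (by omega))
      have e5 : s4.reg 5 = s2.reg 5 := (hf4.2 5 (by omega)).trans (hf3.2 5 (by omega))
      have i7 : s4.idx 7 = s2.idx 7 := (hf4.1 7 (by omega)).trans (hf3.1 7 (by omega))
      refine ⟨hc3.congr (hf4.mono (by omega) (by omega)) fun k hk => hm4 k (Or.inl hk),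
        z', z', hv.congr fun k hk _ => by rw [hm4 k (Or.inr hk), hm3], hy4, ?_, ?_, ?_, ?_, ?_, ?_⟩
      · simpa only [Farthest, i7, e7] using hfar2
      · rw [e6]; exact hfar2.1
      · rw [e6, e7]
      · intro w r hw hr
        rw [e4, e5]
        -- Lowering the best radius leaves fewer balls for the invariant to speak about.
        refine hstep w r hw (hr.trans_le (Real.sqrt_le_sqrt ?_))
        rw [e6, ← r6]
        exact hlt.le
      · rwa [e4]
      · rw [e5, r5]; exact hD
    · simp only [Test.Holds, not_lt] at hle'
      refine ⟨hc2, z', y, hv, hy2, hfar2, ?_, hle', ?_, hk', ?_⟩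
      · simpa only [Instr.exec, r6] using hbest
      · simpa only [Instr.exec, r6] using hstep
      · simpa only [Instr.exec, r5] using hD

/-- Store the points of the boxes nearest to the best point, and the radius. -/
def finish : Prog :=
  .seq (block [.iadd 10 4 6, .iadd 13 5 6, .iconst 11 0, .iadd 12 3 6, .rconst 10 1])
  (.seq (.loop (.ilt 11 3) (.seq row (block [.iadd 11 11 1, .iadd 12 12 1, .iadd 13 13 1])))
    (.instr (.rsqrt 0 6)))

/-- With c = 1 `row` writes the nearest points themselves. They overwrite the current point, which
is no longer needed. -/
theorem finish_spec (hd : 0 < d) {s : Store} (h : Ctx a b ε s) {y : EuclideanSpace ℝ (Fin d)}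
    (hy : VecAt s (2 * (n * d)) y) :
    HaltsWithin finish (n * (d * 19 + 9) + 8) (fun s' => s'.reg 0 = √(s.reg 6) ∧
      VecAt s' (2 * (n * d)) y ∧
      ∀ i : Fin n, VecAt s' (2 * (n * d) + d + i * d) (y + boxDiff (a i) (b i) y)) s := by
  refine (haltsWithin_seq
    (Q := fun s' => Frame 7 7 s s' ∧ s'.mem = s.mem ∧ s'.idx 10 = 2 * (n * d) ∧
      s'.idx 13 = 2 * (n * d) + d ∧ s'.idx 11 = 0 ∧ s'.idx 12 = n * d ∧ s'.reg 10 = 1)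
    (haltsWithin_block ?_) fun s1 h1 => haltsWithin_seq (haltsWithin_loop (N := n)
    (T := (d * 19 + 4) + 4)
    (fun k s' => Frame 7 7 s s' ∧ (∀ q < 2 * (n * d) + d, s'.mem q = s.mem q) ∧
      s'.idx 10 = 2 * (n * d) ∧
      s'.idx 13 = 2 * (n * d) + d + k * d ∧ s'.idx 11 = k * d ∧ s'.idx 12 = n * d + k * d ∧
      s'.reg 10 = 1 ∧ k ≤ n ∧ ∀ i : Fin n, i < k →
        VecAt s' (2 * (n * d) + d + i * d) (y + boxDiff (a i) (b i) y))
    ?_ ?_) ?_).mono (T := 6 + (n * (d * 19 + 4 + 4 + 1) + 1 + 1)) (by ring_nf; omega) fun _ h => h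
  · refine ⟨⟨?_, ?_⟩, ?_⟩
    · intro k hk
      have h1 : k ≠ 10 := by omega
      have h2 : k ≠ 11 := by omega
      have h3 : k ≠ 12 := by omega
      have h4 : k ≠ 13 := by omega
      simp [execBlock, Instr.exec, h1, h2, h3, h4]
    · intro k hk
      have h1 : k ≠ 10 := by omega
      simp [execBlock, Instr.exec, h1]
    · simp [execBlock, Instr.exec, h.idx5, h.idx6, h.idx4, h.idx3]
  · rintro k s' ⟨hf, hm, i10, i13, i11, i12, r10, hk, hv⟩ hb
    have hc : Ctx a b ε s' := h.congr (hf.mono le_rfl (by omega)) fun k _ => hm k (by omega)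
    simp only [Test.Holds, i11, hc.idx3] at hb
    have hkn : k < n := lt_of_mul_lt_mul_right hb (Nat.zero_le d)
    refine ⟨hkn, ?_⟩
    have hkd := fin_mul_add_le (d := d) (⟨k, hkn⟩ : Fin n)
    simp only at hkd
    refine haltsWithin_seq (row_spec_vec (x := y) (l := a ⟨k, hkn⟩) (u := b ⟨k, hkn⟩) hc.idx1
      hc.idx2 (by omega) (by omega) (by omega)
      (by rw [i10]; exact hy.congr fun q _ _ => hm q (by omega))
      (by rw [i11]; exact hc.lower ⟨k, hkn⟩) (by rw [i12]; exact hc.upper ⟨k, hkn⟩)) ?_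
    rintro s1 ⟨hf1, -, hv1, hm1⟩
    rw [i13, r10, one_smul] at hv1
    have hc1 : s1.idx 1 = d := (hf1.1 1 (by omega)).trans hc.idx1
    refine haltsWithin_block ⟨⟨fun j hj => ?_, fun j hj => ?_⟩, ?_, ?_, ?_, ?_, ?_, ?_, hkn, ?_⟩
    · have h1 : j ≠ 11 := by omega
      have h2 : j ≠ 12 := by omega
      have h3 : j ≠ 13 := by omega
      simp [execBlock, Instr.exec, h1, h2, h3, hf1.1 j (by omega), hf.1 j hj]
    · exact (hf1.2 j (by omega)).trans (hf.2 j hj)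
    · intro q hq
      exact (hm1 q (by omega)).trans (hm q hq)
    · simp [execBlock, Instr.exec, hf1.1 10 (by omega), i10]
    · simp [execBlock, Instr.exec, hf1.1 13 (by omega), i13, hc1, Nat.succ_mul, Nat.add_assoc]
    · simp [execBlock, Instr.exec, hf1.1 11 (by omega), i11, hc1, Nat.succ_mul]
    · simp [execBlock, Instr.exec, hf1.1 12 (by omega), i12, hc1, Nat.succ_mul, Nat.add_assoc]
    · exact (hf1.2 10 (by omega)).trans r10
    · intro i hi
      rcases Nat.lt_succ_iff_lt_or_eq.mp hi with hi | rfl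
      · have : (i : ℕ) * d + d ≤ k * d := by
          rw [← Nat.succ_mul]; exact Nat.mul_le_mul_right d hi
        exact (hv i hi).congr fun q _ hq => hm1 q (by omega)
      · exact hv1
  · obtain ⟨hf, hm, i10, i13, i11, i12, r10⟩ := h1
    exact ⟨hf, fun q _ => by rw [hm], i10, by simpa using i13, by simpa using i11,
      by simpa using i12, r10, Nat.zero_le n, by simp⟩
  · rintro s' ⟨k, ⟨hf, hm, i10, i13, i11, i12, r10, hk, hv⟩, hb⟩
    simp only [Test.Holds, i11, (hf.1 3 (by omega)).trans h.idx3, not_lt] at hb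
    obtain rfl : k = n := hk.antisymm (Nat.le_of_mul_le_mul_right hb hd)
    refine haltsWithin_instr ⟨?_, ?_, ?_⟩
    · simp [Instr.exec, hf.2 6 (by omega)]
    · exact hy.congr fun q _ hq => hm q hq
    · exact fun i => hv i i.2

end RealRAM

/-! ### Setup, the complete algorithm and the linear oracle -/

namespace RealRAM

variable {n d : ℕ} {a b : Fin n → EuclideanSpace ℝ (Fin d)} {ε : ℝ}

/-- Compute `n * d` and some constants. -/
def computeSize : Prog :=
  .seq (block [.iconst 2 1, .iconst 6 0, .rconst 2 0, .iconst 3 0, .iconst 20 0])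
  (.loop (.ilt 20 0) (block [.iadd 3 3 1, .iadd 20 20 2]))

/-- Index registers cannot be multiplied, so the product is formed by n additions, within the O(nd)
budget. -/
theorem computeSize_spec {s : Store} (h0 : s.idx 0 = n) (h1 : s.idx 1 = d) :
    HaltsWithin computeSize (n * 4 + 7) (fun s' => Frame 2 2 s s' ∧ s'.mem = s.mem ∧
      s'.idx 2 = 1 ∧ s'.idx 6 = 0 ∧ s'.reg 2 = 0 ∧ s'.idx 3 = n * d) s := by
  refine (haltsWithin_seq
    (Q := fun s' => Frame 2 2 s s' ∧ s'.mem = s.mem ∧ s'.idx 2 = 1 ∧ s'.idx 6 = 0 ∧ s'.reg 2 = 0 ∧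
      s'.idx 3 = 0 ∧ s'.idx 20 = 0)
    (haltsWithin_block ?_) fun s1 hs1 => haltsWithin_loop (N := n) (T := 3)
    (fun k s' => Frame 2 2 s s' ∧ s'.mem = s.mem ∧ s'.idx 2 = 1 ∧ s'.idx 6 = 0 ∧ s'.reg 2 = 0 ∧
      s'.idx 3 = k * d ∧ s'.idx 20 = k ∧ k ≤ n) ?_ ?_).mono (T := 6 + (n * 4 + 1)) (by omega) ?_
  · refine ⟨⟨?_, ?_⟩, ?_⟩
    · intro k hk
      have h1 : k ≠ 2 := by omega
      have h2 : k ≠ 3 := by omega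
      have h3 : k ≠ 6 := by omega
      have h4 : k ≠ 20 := by omega
      simp [execBlock, Instr.exec, h1, h2, h3, h4]
    · intro k hk
      have h1 : k ≠ 2 := by omega
      simp [execBlock, Instr.exec, h1]
    · simp [execBlock, Instr.exec]
  · rintro k s' ⟨hf, hm, i2, i6, r2, i3, i20, hk⟩ hb
    simp only [Test.Holds, i20, (hf.1 0 (by omega)).trans h0] at hb
    refine ⟨hb, haltsWithin_block ⟨⟨fun j hj => ?_, hf.2⟩, hm, ?_⟩⟩
    · have h1 : j ≠ 3 := by omega
      have h2 : j ≠ 20 := by omega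
      simp [execBlock, Instr.exec, h1, h2, hf.1 j hj]
    · have hd : s'.idx 1 = d := (hf.1 1 (by omega)).trans h1
      simpa [execBlock, Instr.exec, i2, i6, r2, i3, i20, hd, Nat.succ_mul] using hb
  · obtain ⟨hf, hm, i2, i6, r2, i3, i20⟩ := hs1
    exact ⟨hf, hm, i2, i6, r2, by simpa using i3, i20, Nat.zero_le n⟩
  · rintro s' ⟨k, ⟨hf, hm, i2, i6, r2, i3, i20, hk⟩, hb⟩
    simp only [Test.Holds, i20, (hf.1 0 (by omega)).trans h0, not_lt] at hb
    obtain rfl : k = n := hk.antisymm hb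
    exact ⟨hf, hm, i2, i6, r2, i3⟩

/-- Start the descent at the lower corner of the first box. -/
def setup : Prog :=
  .seq computeSize (.seq (block [.iadd 4 3 3, .iadd 5 4 1, .rconst 10 1, .radd 11 10 0,
    .rdiv 1 0 11, .rmul 3 1 1, .iadd 10 3 6, .iconst 11 0, .iconst 12 0, .iadd 13 5 6])
  (.seq row (.seq (block [.radd 5 11 2]) (.seq scan (.seq (block [.radd 6 7 2]) (.seq copyBest
    (block [.radd 5 5 6, .radd 5 5 5, .rconst 4 0])))))))

/-- From the corner a₀, with squared distance M to the farthest box, the bound is 2(‖a₀ - b₀‖² + M).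
It covers every centre w of a ball with (1+ε)r < √M, and it is at most 4D², both terms being squared
distances between input points. -/
theorem setup_spec (hn : 0 < n) (hd : 0 < d) (hab : ∀ i j, a i j ≤ b i j) (hε : 0 < ε)
    {s : Store} (h0 : s.idx 0 = n) (h1 : s.idx 1 = d) (hr : s.reg 0 = ε) (hsa : Stored s 0 a)
    (hsb : Stored s (n * d) b) :
    HaltsWithin setup (n * (d * 19 + 16) + d * 38 + 49) (Descent a b ε 0) s := by
  set i0 : Fin n := ⟨0, hn⟩ with hi0
  have ha0 : a i0 ∈ aabb (a i0) (b i0) := fun j => ⟨le_rfl, hab i0 j⟩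
  have hb0 : b i0 ∈ aabb (a i0) (b i0) := fun j => ⟨hab i0 j, le_rfl⟩
  have hnd := fin_mul_add_le (d := d) i0
  simp only [hi0] at hnd
  refine (haltsWithin_seq (computeSize_spec h0 h1) fun s1 hs1 => haltsWithin_seq
    (Q := fun s' => Ctx a b ε s' ∧ s'.idx 10 = n * d ∧ s'.idx 11 = 0 ∧ s'.idx 12 = 0 ∧
      s'.idx 13 = 2 * (n * d) + d ∧ s'.reg 10 = 1)
    (haltsWithin_block ?_) fun s2 hs2 => haltsWithin_seq
    (Q := fun s' => Ctx a b ε s' ∧ VecAt s' (2 * (n * d) + d) (a i0) ∧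
      s'.reg 11 = ‖a i0 - b i0‖ ^ 2) (T := d * 19 + 4) ?_ fun s3 hs3 => haltsWithin_seq
    (Q := fun s' => Ctx a b ε s' ∧ VecAt s' (2 * (n * d) + d) (a i0) ∧
      s'.reg 5 = ‖a i0 - b i0‖ ^ 2) (haltsWithin_block ?_) fun s4 hs4 => haltsWithin_seq
    (scan_spec hn hd hs4.1 hs4.2.1) fun s5 hs5 => haltsWithin_seq
    (Q := fun s' => Ctx a b ε s' ∧ VecAt s' (2 * (n * d) + d) (a i0) ∧
      s'.reg 5 = ‖a i0 - b i0‖ ^ 2 ∧ Farthest a b (a i0) s' ∧ s'.reg 6 = s'.reg 7)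
    (haltsWithin_block ?_) fun s6 hs6 => haltsWithin_seq (copyBest_spec hn hs6.1 hs6.2.1)
    fun s7 hs7 => haltsWithin_block ?_).mono
    (T := (n * 4 + 7) + (11 + ((d * 19 + 4) + (2 + ((n * (d * 19 + 12) + 9) +
      (2 + ((d * 19 + 10) + 4))))))) (by ring_nf; omega) fun _ h => h
  · obtain ⟨hf, hm, i2, i6, r2, i3⟩ := hs1
    have e0 := (hf.1 0 (by omega)).trans h0
    have e1 := (hf.1 1 (by omega)).trans h1
    have er := (hf.2 0 (by omega)).trans hr
    refine ⟨⟨?_, ?_, ?_, ?_, ?_, ?_, ?_, ?_, ?_, ?_, fun i j => ?_, fun i j => ?_⟩, ?_⟩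
    iterate 10 simp [execBlock, Instr.exec, i2, i6, r2, i3, e0, e1, er, two_mul]
    · simpa [execBlock, Instr.exec, hm] using hsa i j
    · simpa [execBlock, Instr.exec, hm, Nat.add_assoc] using hsb i j
    · simp [execBlock, Instr.exec, i6, i3, e1, two_mul]
  · obtain ⟨hc, i10, i11, i12, i13, r10⟩ := hs2
    have va : VecAt s2 0 (a i0) := by simpa [hi0] using hc.lower i0
    have vb : VecAt s2 (n * d) (b i0) := by simpa [hi0] using hc.upper i0
    -- Projecting b₀ with c = 1 onto the one-point box a₀ places the start point and yields ‖a₀ -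
    -- b₀‖² in one pass.
    refine (row_spec_vec (x := b i0) (l := a i0) (u := a i0) hc.idx1
      hc.idx2 (by omega) (by omega) (by omega) (by rwa [i10]) (by rwa [i11]) (by rwa [i12])).mono
      le_rfl ?_
    rintro s' ⟨hf', hs, hv, hk⟩
    rw [boxDiff_self] at hs hv
    rw [r10, one_smul, add_sub_cancel, i13] at hv
    exact ⟨hc.congr (hf'.mono (by omega) (by omega)) fun k hk' => hk k (by omega), hv, hs⟩
  · obtain ⟨hc, hv, h11⟩ := hs3
    refine ⟨hc.congr ⟨fun _ _ => rfl, fun k hk => ?_⟩ fun _ _ => rfl, hv, ?_⟩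
    · have h1 : k ≠ 5 := by omega
      simp [execBlock, Instr.exec, h1]
    · simp [execBlock, Instr.exec, hc.reg2, h11]
  · obtain ⟨hc, hv, h5⟩ := hs4
    obtain ⟨hf, hm, hfar⟩ := hs5
    refine ⟨hc.congr ⟨hf.1, fun k hk => ?_⟩ fun k _ => by simp [execBlock, Instr.exec, hm],
      hv.congr fun k _ _ => by simp [execBlock, Instr.exec, hm], ?_, ?_, ?_⟩
    · have h1 : k ≠ 6 := by omega
      simp [execBlock, Instr.exec, h1, hf.2 k (by omega)]
    · simp [execBlock, Instr.exec, hf.2 5 (by omega), h5]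
    · simpa [execBlock, Instr.exec, Farthest] using hfar
    · simp [execBlock, Instr.exec, (hf.2 2 (by omega)).trans hc.reg2]
  · obtain ⟨hc, hv, h5, hfar, h67⟩ := hs6
    obtain ⟨hf, hy, hm⟩ := hs7
    have hc7 : Ctx a b ε s7 := hc.congr (hf.mono (by omega) (by omega)) fun k hk => hm k (by omega)
    have e5 : (execBlock [.radd 5 5 6, .radd 5 5 5, .rconst 4 0] s7).reg 5 =
        2 * (‖a i0 - b i0‖ ^ 2 + s6.reg 7) := by
      simp [execBlock, Instr.exec, hf.2 5 (by omega), hf.2 6 (by omega), h5, h67, two_mul]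
    have e6 : (execBlock [.radd 5 5 6, .radd 5 5 5, .rconst 4 0] s7).reg 6 = s6.reg 7 := by
      simp [execBlock, Instr.exec, hf.2 6 (by omega), h67]
    have e7 : (execBlock [.radd 5 5 6, .radd 5 5 5, .rconst 4 0] s7).reg 7 = s6.reg 7 := by
      simp [execBlock, Instr.exec, hf.2 7 (by omega)]
    have e4 : (execBlock [.radd 5 5 6, .radd 5 5 5, .rconst 4 0] s7).reg 4 = 0 := by
      simp [execBlock, Instr.exec]
    have ei7 : (execBlock [.radd 5 5 6, .radd 5 5 5, .rconst 4 0] s7).idx 7 = s6.idx 7 := by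
      simp [execBlock, Instr.exec, hf.1 7 (by omega)]
    refine ⟨hc7.congr ⟨fun _ _ => rfl, fun k hk => ?_⟩ fun _ _ => rfl, a i0, a i0,
      (hv.congr fun k hk _ => hm k (Or.inr hk) : VecAt s7 _ _), hy, ?_, ?_, ?_, ?_, ?_, ?_⟩
    · have h1 : k ≠ 4 := by omega
      have h2 : k ≠ 5 := by omega
      simp [execBlock, Instr.exec, h1, h2]
    · simpa only [Farthest, e7, ei7] using hfar
    · rw [e6]; exact hfar.1
    · rw [e6, e7]
    · intro w r hw hwr
      rw [e6] at hwr
      rw [e4, e5, add_zero]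
      refine (norm_sub_sq_le_of_mem_aabb ha0 (hw.2 i0)).trans ?_
      rw [norm_sub_rev (b i0)]
      have h1 : r ≤ √(s6.reg 7) := by nlinarith [hw.1]
      have h2 := Real.sq_sqrt ((sq_nonneg _).trans (hfar.1 i0))
      have h3 := pow_le_pow_left₀ hw.1 h1 2
      linarith
    · rw [e4]; simp
    · obtain ⟨-, i, -, hM⟩ := hfar
      have h1 := norm_sub_le_inputDiam (a := a) (b := b) ha0 hb0
      have h2 := norm_sub_le_inputDiam (a := a) (b := b) (add_boxDiff_mem (hab i) (a i0)) ha0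
      rw [add_sub_cancel_left] at h2
      have h3 := pow_le_pow_left₀ (norm_nonneg _) h1 2
      have h4 := pow_le_pow_left₀ (norm_nonneg _) h2 2
      rw [e5, hM]
      linarith

/-- The approximation algorithm for smallest intersecting balls of boxes. -/
def approxSIB : Prog :=
  .seq setup (.seq (.loop (.rle 4 5) descentBody) finish)

theorem approxSIB_spec (hn : 0 < n) (hd : 0 < d) (hab : ∀ i j, a i j ≤ b i j) (hε : 0 < ε)
    (hpos : 0 < sibRadius (fun i => aabb (a i) (b i)))
    {s : Store} (h0 : s.idx 0 = n) (h1 : s.idx 1 = d) (hr : s.reg 0 = ε) (hsa : Stored s 0 a)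
    (hsb : Stored s (n * d) b) {N : ℕ}
    (hN : 4 * inputRatio (fun i => aabb (a i) (b i)) ^ 2 * ((1 + ε) / ε) ^ 2 < N) :
    HaltsWithin approxSIB (n * (d * 38 + 25) + d * 38 + 58 +
        N * (n * (d * 19 + 12) + d * 38 + 35)) (fun s' => ∃ y,
      Stored s' (2 * (n * d)) (fun _ : Fin 1 => y) ∧
      Stored s' (2 * (n * d) + d) (fun i => y + boxDiff (a i) (b i) y) ∧
      IsApproxSIB (fun i => aabb (a i) (b i)) ε y (s'.reg 0) ∧
      ∀ i, ‖boxDiff (a i) (b i) y‖ ≤ s'.reg 0) s := by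
  refine (haltsWithin_seq (setup_spec hn hd hab hε h0 h1 hr hsa hsb) fun s1 hs1 =>
    haltsWithin_seq (haltsWithin_loop (N := N) (Descent a b ε) ?_ hs1) ?_).mono
    (T := (n * (d * 19 + 16) + d * 38 + 49) +
      ((N * ((n * (d * 19 + 12) + d * 38 + 34) + 1) + 1) + (n * (d * 19 + 9) + 8)))
    (by ring_nf; omega) fun _ h => h
  · intro k s hD hb
    refine ⟨?_, descentBody_spec hn hd hab hε hD⟩
    obtain ⟨-, z, y, -, -, -, -, -, -, hk, h4⟩ := hD
    simp only [Test.Holds] at hb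
    -- While the loop runs, kλ²r*² ≤ register 4 ≤ register 5 ≤ 4D².
    have h5 := hk.trans (hb.trans h4)
    rw [← Nat.cast_lt (α := ℝ)]
    refine lt_of_le_of_lt ?_ hN
    rw [inputRatio]
    set ρ := sibRadius (fun i => aabb (a i) (b i))
    set D := inputDiam (fun i => aabb (a i) (b i))
    have : 4 * (D / ρ) ^ 2 * ((1 + ε) / ε) ^ 2 =
        4 * D ^ 2 / (ε / (1 + ε) * (ε / (1 + ε)) * ρ ^ 2) := by
      field_simp
    rw [this, le_div_iff₀ (by positivity)]
    exact h5
  · rintro s2 ⟨k, ⟨hc, z, y, -, hy, -, hbest, -, hinv, -, -⟩, hb⟩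
    simp only [Test.Holds, not_le] at hb
    refine (finish_spec hd hc hy).mono le_rfl ?_
    rintro s3 ⟨hr3, hy3, hv3⟩
    have hbest' : ∀ i, ‖boxDiff (a i) (b i) y‖ ≤ s3.reg 0 := fun i => by
      rw [hr3]
      exact Real.le_sqrt_of_sq_le (hbest i)
    refine ⟨y, fun i j => ?_, fun i j => ?_, ⟨?_, ?_⟩, hbest'⟩
    · have := hy3 j
      simpa using this
    · rw [← Nat.add_assoc]
      exact hv3 i j
    · exact isIntersectingBall_of_norm_boxDiff_le hab (by rw [hr3]; positivity) hbest'
    · rw [mul_comm, ← div_le_iff₀ (by positivity)]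
      refine le_csInf (exists_isIntersectingBall hab) ?_
      rintro r ⟨w, hw⟩
      rw [div_le_iff₀ (by positivity), mul_comm, hr3]
      by_contra! hlt
      have := hinv w r hw hlt
      -- On exit register 4 exceeds register 5, so the invariant would make a square negative.
      nlinarith [sq_nonneg ‖z - w‖]

/-- The linear oracle for boxes. -/
def linearOracle : Prog :=
  .seq computeSize (.seq (block [.iadd 4 3 3, .iadd 5 4 3, .iconst 20 0])
  (.loop (.ilt 20 3) (.seq (block [.iadd 21 4 20, .load 12 21, .iadd 21 3 20])
    (.seq (.ite (.rlt 2 12) (.instr (.load 13 20)) (.instr (.load 13 21)))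
      (block [.iadd 21 5 20, .store 21 13, .iadd 20 20 2])))))

/-- The three input arrays share one layout, so a single loop over n * d cells suffices; the output
lies above them and destroys no input. -/
theorem linearOracle_spec {h : Fin n → EuclideanSpace ℝ (Fin d)} {s : Store} (h0 : s.idx 0 = n)
    (h1 : s.idx 1 = d) (hsa : Stored s 0 a) (hsb : Stored s (n * d) b)
    (hsh : Stored s (2 * (n * d)) h) :
    HaltsWithin linearOracle (n * 4 + n * d * 11 + 12) (fun s' =>
      Stored s' (3 * (n * d)) (fun i => signPoint (a i) (b i) (h i))) s := by
  set val : ℕ → ℝ := fun k => if 0 < s.mem (2 * (n * d) + k) then s.mem k else s.mem (n * d + k)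
    with hval
  refine (haltsWithin_seq (computeSize_spec h0 h1) fun s1 hs1 => haltsWithin_seq
    (Q := fun s' => s'.mem = s.mem ∧ s'.idx 2 = 1 ∧ s'.idx 3 = n * d ∧ s'.idx 4 = 2 * (n * d) ∧
      s'.idx 5 = 3 * (n * d) ∧ s'.reg 2 = 0 ∧ s'.idx 20 = 0)
    (haltsWithin_block ?_) fun s2 hs2 => haltsWithin_loop (N := n * d) (T := 4 + (2 + 4))
    (fun k s' => s'.idx 2 = 1 ∧ s'.idx 3 = n * d ∧ s'.idx 4 = 2 * (n * d) ∧
      s'.idx 5 = 3 * (n * d) ∧ s'.reg 2 = 0 ∧ s'.idx 20 = k ∧ k ≤ n * d ∧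
      (∀ q < 3 * (n * d), s'.mem q = s.mem q) ∧ ∀ q < k, s'.mem (3 * (n * d) + q) = val q)
    ?_ ?_).mono (T := (n * 4 + 7) + (4 + (n * d * 11 + 1))) (by omega) ?_
  · obtain ⟨hf, hm, i2, i6, r2, i3⟩ := hs1
    simp [execBlock, Instr.exec, i2, i3, r2, hm]
    omega
  · rintro k s' ⟨i2, i3, i4, i5, r2, i20, hk, hm, hw⟩ hb
    simp only [Test.Holds, i20, i3] at hb
    refine ⟨hb, haltsWithin_seq
      (Q := fun s3 => s3.mem = s'.mem ∧ s3.idx 2 = 1 ∧ s3.idx 3 = n * d ∧ s3.idx 4 = 2 * (n * d) ∧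
        s3.idx 5 = 3 * (n * d) ∧ s3.reg 2 = 0 ∧ s3.idx 20 = k ∧
        s3.idx 21 = n * d + k ∧ s3.reg 12 = s.mem (2 * (n * d) + k))
      (haltsWithin_block ?_) fun s3 hs3 => haltsWithin_seq
      (Q := fun s4 => s4.mem = s'.mem ∧ s4.idx 2 = 1 ∧ s4.idx 3 = n * d ∧ s4.idx 4 = 2 * (n * d) ∧
        s4.idx 5 = 3 * (n * d) ∧ s4.reg 2 = 0 ∧ s4.idx 20 = k ∧ s4.reg 13 = val k)
      (haltsWithin_ite (fun hb' => haltsWithin_instr ?_) (fun hb' => haltsWithin_instr ?_))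
      fun s4 hs4 => haltsWithin_block ?_⟩
    · simp [execBlock, Instr.exec, i2, i3, i4, i5, r2, i20, hm (2 * (n * d) + k) (by omega)]
    · obtain ⟨g, g2, g3, g4, g5, gr, g20, g21, g12⟩ := hs3
      simp only [Test.Holds, gr, g12] at hb'
      simp [Instr.exec, g, g2, g3, g4, g5, gr, g20, hval, hb', hm k (by omega)]
    · obtain ⟨g, g2, g3, g4, g5, gr, g20, g21, g12⟩ := hs3
      simp only [Test.Holds, gr, g12] at hb'
      simp [Instr.exec, g, g2, g3, g4, g5, gr, g20, g21, hval, hb', hm (n * d + k) (by omega)]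
    · obtain ⟨g, g2, g3, g4, g5, gr, g20, g13⟩ := hs4
      have hmem : (execBlock [.iadd 21 5 20, .store 21 13, .iadd 20 20 2] s4).mem =
          Function.update s'.mem (3 * (n * d) + k) (val k) := by
        simp [execBlock, Instr.exec, g, g5, g20, g13]
      refine ⟨?_, ?_, ?_, ?_, gr, ?_, hb, fun q hq => ?_, fun q hq => ?_⟩
      iterate 5 simp [execBlock, Instr.exec, g2, g3, g4, g5, g20]
      · rw [hmem, Function.update_of_ne (by omega), hm q hq]
      · rw [hmem]
        rcases Nat.lt_succ_iff_lt_or_eq.mp hq with hq | rfl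
        · rw [Function.update_of_ne (by omega), hw q hq]
        · rw [Function.update_self]
  · obtain ⟨hm, i2, i3, i4, i5, r2, i20⟩ := hs2
    exact ⟨i2, i3, i4, i5, r2, i20, Nat.zero_le _, fun q _ => by rw [hm], by simp⟩
  · rintro s' ⟨k, ⟨i2, i3, i4, i5, r2, i20, hk, hm, hw⟩, hb⟩ i j
    simp only [Test.Holds, i20, i3, not_lt] at hb
    have hij := fin_mul_add_le (d := d) i
    rw [hw _ (by omega), hval]
    have e1 := hsa i j
    rw [Nat.zero_add] at e1
    simp only [hsh i j, hsb i j, e1, signPoint]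

end RealRAM

/-! ### Constants and the main theorem -/

/-- The input ratio is at least one. -/
theorem one_le_inputRatio {n d : ℕ} {a b : Fin n → EuclideanSpace ℝ (Fin d)} (hn : 0 < n)
    (hab : ∀ i j, a i j ≤ b i j) (hpos : 0 < sibRadius (fun i => aabb (a i) (b i))) :
    1 ≤ inputRatio (fun i => aabb (a i) (b i)) := by
  rw [inputRatio, one_le_div hpos]
  have ha0 : a ⟨0, hn⟩ ∈ aabb (a ⟨0, hn⟩) (b ⟨0, hn⟩) := fun j => ⟨le_rfl, hab _ j⟩
  -- The ball of radius D around any input point meets every box.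
  refine sibRadius_le (z := a ⟨0, hn⟩) (isIntersectingBall_of_norm_boxDiff_le hab
    Metric.diam_nonneg fun i => ?_)
  have := norm_sub_le_inputDiam (a := a) (b := b) (add_boxDiff_mem (hab i) (a ⟨0, hn⟩)) ha0
  rwa [add_sub_cancel_left] at this

theorem one_add_div_le_two_div_min {ε : ℝ} (hε : 0 < ε) : (1 + ε) / ε ≤ 2 / min 1 ε := by
  rw [div_le_div_iff₀ hε (lt_min one_pos hε)]
  rcases le_total 1 ε with h | h
  · rw [min_eq_left h]; linarith
  · rw [min_eq_right h]; nlinarith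

theorem mainTheorem5 :
    -- the approximation algorithm
    (∃ (P : RealRAM.Prog) (C : ℝ), 0 < C ∧
      ∀ (n d : ℕ), 1 < n →
      ∀ (a b : Fin n → EuclideanSpace ℝ (Fin d)), (∀ i j, a i j ≤ b i j) →
      (⋂ i, aabb (a i) (b i)) = ∅ →
      ∀ (ε : ℝ), 0 < ε →
      ∀ s : RealRAM.Store, s.idx 0 = n → s.idx 1 = d → s.reg 0 = ε →
        RealRAM.Stored s 0 a → RealRAM.Stored s (n * d) b →
      ∃ (t : ℕ) (s' : RealRAM.Store) (z : EuclideanSpace ℝ (Fin d))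
        (v : Fin n → EuclideanSpace ℝ (Fin d)),
        RealRAM.Runs P s t s' ∧
        RealRAM.Stored s' (2 * (n * d)) (fun _ : Fin 1 => z) ∧
        RealRAM.Stored s' (2 * (n * d) + d) v ∧
        IsApproxSIB (fun i => aabb (a i) (b i)) ε z (s'.reg 0) ∧
        (∀ i, v i ∈ aabb (a i) (b i) ∧ ‖z - v i‖ ≤ s'.reg 0) ∧
        (t : ℝ) ≤ C * (inputRatio (fun i => aabb (a i) (b i)) ^ 2 * n * d * Real.log n /
          (min 1 ε) ^ 2)) ∧
    -- the linear oracle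
    (∃ (Q : RealRAM.Prog) (C : ℝ), 0 < C ∧
      ∀ (n d : ℕ), 0 < n → 0 < d →
      ∀ (a b h : Fin n → EuclideanSpace ℝ (Fin d)), (∀ i j, a i j ≤ b i j) →
      ∀ s : RealRAM.Store, s.idx 0 = n → s.idx 1 = d →
        RealRAM.Stored s 0 a → RealRAM.Stored s (n * d) b → RealRAM.Stored s (2 * (n * d)) h →
      ∃ (t : ℕ) (s' : RealRAM.Store),
        RealRAM.Runs Q s t s' ∧
        RealRAM.Stored s' (3 * (n * d)) (fun i => signPoint (a i) (b i) (h i)) ∧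
        (∀ i, signPoint (a i) (b i) (h i) ∈ aabb (a i) (b i) ∧
          IsMinOn (fun u => inner ℝ (h i) u) (aabb (a i) (b i))
            (signPoint (a i) (b i) (h i))) ∧
        (t : ℝ) ≤ C * (n * d)) := by
  refine ⟨⟨RealRAM.approxSIB, 4000, by norm_num, ?_⟩, RealRAM.linearOracle, 27, by norm_num, ?_⟩
  · intro n d hn a b hab hempty ε hε s h0 h1 hr hsa hsb
    have hn0 : 0 < n := by omega
    have hd : 0 < d := by
      obtain ⟨-, -, j, -⟩ := exists_lt_of_iInter_aabb_eq_empty hn0 hempty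
      -- In dimension 0 all boxes would share the only point, so empty intersection forces d > 0.
      exact j.pos
    have hpos := sibRadius_pos hn0 hab hempty
    have hR := one_le_inputRatio hn0 hab hpos
    set R := inputRatio (fun i => aabb (a i) (b i))
    obtain ⟨t, s', hrun, ht, y, hy, hv, happrox, hle⟩ := RealRAM.approxSIB_spec hn0 hd hab hε hpos
      h0 h1 hr hsa hsb (Nat.lt_floor_add_one (4 * R ^ 2 * ((1 + ε) / ε) ^ 2) |> fun h => by
        exact_mod_cast h)
    refine ⟨t, s', y, _, hrun, hy, hv, happrox, fun i => ⟨add_boxDiff_mem (hab i) y, ?_⟩, ?_⟩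
    · simpa using hle i
    · have hμ : 0 < min 1 ε := lt_min one_pos hε
      set N := ⌊4 * R ^ 2 * ((1 + ε) / ε) ^ 2⌋₊ + 1 with hNdef
      set X := R ^ 2 / (min 1 ε) ^ 2 with hX
      have hX1 : 1 ≤ X := by
        rw [hX, one_le_div (by positivity)]
        exact pow_le_pow_left₀ hμ.le ((min_le_left _ _).trans hR) 2
      -- 16X from the round count, and one more X ≥ 1 to absorb the rounding.
      have hN : (N : ℝ) ≤ 17 * X := by
        have e1 : (N : ℝ) ≤ 4 * R ^ 2 * ((1 + ε) / ε) ^ 2 + 1 := by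
          rw [hNdef, Nat.cast_add, Nat.cast_one]
          gcongr
          exact Nat.floor_le (by positivity)
        have e2 : 4 * R ^ 2 * ((1 + ε) / ε) ^ 2 ≤ 4 * R ^ 2 * (2 / min 1 ε) ^ 2 :=
          mul_le_mul_of_nonneg_left (pow_le_pow_left₀ (by positivity)
            (one_add_div_le_two_div_min hε) 2) (by positivity)
        have e3 : 4 * R ^ 2 * (2 / min 1 ε) ^ 2 = 16 * X := by rw [hX]; ring
        linarith
      have hnR : (1 : ℝ) ≤ n := by exact_mod_cast hn0
      have hdR : (1 : ℝ) ≤ d := by exact_mod_cast hd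
      have ht' : (t : ℝ) ≤ n * (d * 38 + 25) + d * 38 + 58 +
        N * (n * (d * 19 + 12) + d * 38 + 35) := by exact_mod_cast ht
      have hn1 : (n : ℝ) ≤ n * d := le_mul_of_one_le_right (by linarith) hdR
      have hd1 : (d : ℝ) ≤ n * d := le_mul_of_one_le_left (by linarith) hnR
      have hlog : 1 ≤ 2 * Real.log n := by
        have := Real.log_le_log two_pos (by exact_mod_cast hn : (2 : ℝ) ≤ n)
        linarith [Real.log_two_gt_d9]
      have hp : (0 : ℝ) ≤ n * d := by positivity
      have hXp : (n * d : ℝ) ≤ X * (n * d) := le_mul_of_one_le_left hp hX1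
      -- 104 = 19 + 12 + 38 + 35. With 159 from the other phases, 17 · 104 + 159 ≤ 2000, and 2 log n
      -- ≥ 1 doubles this to 4000.
      have h2 : (N : ℝ) * (n * (d * 19 + 12) + d * 38 + 35) ≤ 17 * X * (104 * (n * d)) := by
        gcongr
        linarith
      calc (t : ℝ) ≤ 2000 * (X * (n * d)) := by linarith
        _ ≤ 2000 * (X * (n * d)) * (2 * Real.log n) :=
          le_mul_of_one_le_right (by positivity) hlog
        _ = _ := by rw [hX]; ring
  · intro n d hn hd a b h hab s h0 h1 hsa hsb hsh
    obtain ⟨t, s', hrun, ht, hst⟩ := RealRAM.linearOracle_spec h0 h1 hsa hsb hsh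
    refine ⟨t, s', hrun, hst, fun i =>
      ⟨signPoint_mem_aabb (hab i) (h i), isMinOn_signPoint _ _ _⟩, ?_⟩
    -- 27 = 4 + 11 + 12, since n and 1 are at most nd.
    have h2 : t ≤ 27 * (n * d) := by
      have := Nat.le_mul_of_pos_right n hd
      have := Nat.mul_pos hn hd
      omega
    exact_mod_cast h2
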